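/- Let $M\in\mathbb F_2^{m\times n}$ and $b\in\mathbb F_2^m$, and assume that every column of $M$ is nonzero, i.e. every variable occurs in at least one equation of $Mx=b$. For $k\in[m]$ put $S_k=\{i\in[n]:M_{ki}=1\}$. All tensor products of $C^*$-algebras are minimal, and all $C^*$-algebras and $*$-homomorphisms are unital. **The group.** Let $\Gamma=\Gamma_0(M)$ be the homogeneous solution group: the group generated by $x_1,\dots,x_n$ subject to $x_i^2=1$ for all $i$; $x_ix_j=x_jx_i$ whenever $i,j\in S_k$ for some $k$; and $\prod_{i\in S_k}x_i=1$ for all $k\in[m]$. Let $C^*(\Gamma)$ be its full group $C^*$-algebra, i.e. the universal $C^*$-algebra generated by unitaries $u_g$, $g\in\Gamma$, with $u_{gh}=u_gu_h$ and $u_{g^{-1}}=u_g^*$, and let $\Delta_\Gamma:C^*(\Gamma)\to C^*(\Gamma)\otimes C^*(\Gamma)$ be the $*$-homomorphism with $\Delta_\Gamma(u_g)=u_g\otimes u_g$ for $g\in\Gamma$. **The graph.** Let $G=G(M,b)$ be the following vertex- and edge-colored graph. Its vertices are the pairs $(k,\alpha)$ with $k\in[m]$ and $\alpha:S_k\to\{1,-1\}$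 such that $\prod_{i\in S_k}\alpha_i=(-1)^{b_k}$. The vertex $(k,\alpha)$ has color $k$. Distinct vertices $(l,\alpha)$ and $(k,\beta)$ are adjacent if and only if $S_l\cap S_k\neq\varnothing$, and the color of the edge joining them is the function $\alpha\triangle\beta:S_l\cap S_k\to\{1,-1\}$, $i\mapsto\alpha_i\beta_i$. **Its quantum automorphism group.** Let $C(\mathrm{Qut}(G))$ be the universal $C^*$-algebra with generators $u_{ij}$, $i,j\in V(G)$, and relations $u_{ij}=u_{ij}^*=u_{ij}^2$ and $\sum_l u_{il}=1=\sum_l u_{li}$ for all $i,j$; $u_{ij}=0$ whenever $i$ and $j$ have different colors; and $A_{G_c}u=uA_{G_c}$ for every edge color $c$, where $u=(u_{ij})$ and $A_{G_c}$ is the adjacency matrix of the edges of color $c$. Let $\Delta_G:C(\mathrm{Qut}(G))\to C(\mathrm{Qut}(G))\otimes C(\mathrm{Qut}(G))$ be the $*$-homomorphism with $\Delta_G(u_{ac})=\sum_{d\in V(G)}u_{ad}\otimes u_{dc}$ for all $a,c\in V(G)$. **Theorem.** There is a $*$-isomorphism $\varphi:C^*(\Gamma)\to C(\mathrm{Qut}(G))$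 such that $\Delta_G\circ\varphi=(\varphi\otimes\varphi)\circ\Delta_\Gamma$. That is, the quantum automorphism group of $G(M,b)$ is the dual of the homogeneous solution group $\Gamma_0(M)$. -/

import Mathlib

open scoped TensorProduct

noncomputable section

universe u v w

/-! ### C*-seminorms and the C*-algebras obtained by completion -/

/-- A C*-seminorm on a unital complex `*`-algebra: a submultiplicative seminorm satisfying the
C*-identity. -/
structure CStarSeminorm (A : Type u) [Ring A] [StarRing A] [Algebra ℂ A] extends
    Seminorm ℂ A where
  mul_le' : ∀ a b : A, toFun (a * b) ≤ toFun a * toFun b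
  star_mul_self' : ∀ a : A, toFun (star a * a) = toFun a ^ 2

namespace CStarSeminorm

variable {A : Type u} [Ring A] [StarRing A] [Algebra ℂ A]

instance : CoeFun (CStarSeminorm A) (fun _ => A → ℝ) := ⟨fun p => p.toFun⟩

lemma nonneg (p : CStarSeminorm A) (a : A) : 0 ≤ p a := apply_nonneg p.toSeminorm a
lemma add_le (p : CStarSeminorm A) (a b : A) : p (a + b) ≤ p a + p b :=
  map_add_le_add p.toSeminorm a b
lemma smul_eq (p : CStarSeminorm A) (c : ℂ) (a : A) : p (c • a) = ‖c‖ * p a :=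
  map_smul_eq_mul p.toSeminorm c a
lemma map_zero (p : CStarSeminorm A) : p 0 = 0 := _root_.map_zero p.toSeminorm
lemma mul_le (p : CStarSeminorm A) (a b : A) : p (a * b) ≤ p a * p b := p.mul_le' a b
lemma star_mul_self (p : CStarSeminorm A) (a : A) : p (star a * a) = p a ^ 2 :=
  p.star_mul_self' a

lemma le_star (p : CStarSeminorm A) (a : A) : p a ≤ p (star a) := by
  by_contra! h
  have h1 := p.star_mul_self a
  have h2 := p.mul_le (star a) a
  have h3 := p.nonneg (star a)
  nlinarith

lemma star_eq (p : CStarSeminorm A) (a : A) : p (star a) = p a :=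
  le_antisymm (by simpa using p.le_star (star a)) (p.le_star a)

lemma one_le (p : CStarSeminorm A) : p 1 ≤ 1 := by
  have h := p.star_mul_self 1
  rw [star_one, mul_one] at h
  nlinarith [p.nonneg 1]

/-- The algebra `A`, regarded as a seminormed ring by means of `p`. -/
def Pre (_p : CStarSeminorm A) : Type u := A

instance (p : CStarSeminorm A) : Ring p.Pre := inferInstanceAs (Ring A)
instance (p : CStarSeminorm A) : StarRing p.Pre := inferInstanceAs (StarRing A)
instance (p : CStarSeminorm A) : Algebra ℂ p.Pre := inferInstanceAs (Algebra ℂ A)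
instance (p : CStarSeminorm A) [StarModule ℂ A] : StarModule ℂ p.Pre :=
  inferInstanceAs (StarModule ℂ A)

instance (p : CStarSeminorm A) : SeminormedRing p.Pre :=
  fast_instance%
  { (inferInstance : Ring p.Pre), p.toSeminorm.toAddGroupSeminorm.toSeminormedAddCommGroup with
    norm_mul_le := fun a b => p.mul_le a b }

instance (p : CStarSeminorm A) : NormedAlgebra ℂ p.Pre where
  norm_smul_le c a := (p.smul_eq c a).le

/-- The identity map `A → A`, with the target seminormed by `p`. -/
def toPre (p : CStarSeminorm A) : A ≃ₐ[ℂ] p.Pre := AlgEquiv.refl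

lemma norm_toPre (p : CStarSeminorm A) (a : A) : ‖p.toPre a‖ = p a := rfl

lemma toPre_star (p : CStarSeminorm A) (a : A) : p.toPre (star a) = star (p.toPre a) := rfl

lemma pre_norm_star (p : CStarSeminorm A) (a : p.Pre) : ‖star a‖ = ‖a‖ := p.star_eq a

/-- The Hausdorff completion of `A` with respect to `p`. -/
def Completion (p : CStarSeminorm A) : Type u := UniformSpace.Completion p.Pre

instance (p : CStarSeminorm A) : NormedRing p.Completion :=
  inferInstanceAs (NormedRing (UniformSpace.Completion p.Pre))
instance (p : CStarSeminorm A) : CompleteSpace p.Completion :=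
  inferInstanceAs (CompleteSpace (UniformSpace.Completion p.Pre))
instance (p : CStarSeminorm A) : Algebra ℂ p.Completion :=
  inferInstanceAs (Algebra ℂ (UniformSpace.Completion p.Pre))
instance (p : CStarSeminorm A) : NormedAlgebra ℂ p.Completion where
  norm_smul_le := norm_smul_le (α := ℂ) (β := UniformSpace.Completion p.Pre)

/-- The canonical map from `A` to its completion, as an algebra homomorphism. -/
def ofAlgHom (p : CStarSeminorm A) : A →ₐ[ℂ] p.Completion where
  toFun a := ((p.toPre a : p.Pre) : UniformSpace.Completion p.Pre)
  map_one' := UniformSpace.Completion.coe_one p.Pre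
  map_mul' a b := UniformSpace.Completion.coe_mul (p.toPre a) (p.toPre b)
  map_zero' := UniformSpace.Completion.coe_zero
  map_add' a b := UniformSpace.Completion.coe_add (p.toPre a) (p.toPre b)
  commutes' _ := rfl

lemma norm_ofAlgHom (p : CStarSeminorm A) (a : A) : ‖p.ofAlgHom a‖ = p a :=
  UniformSpace.Completion.norm_coe (p.toPre a)

lemma denseRange_ofAlgHom (p : CStarSeminorm A) : DenseRange p.ofAlgHom :=
  UniformSpace.Completion.denseRange_coe (α := p.Pre)

lemma uniformContinuous_star (p : CStarSeminorm A) :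
    UniformContinuous (star : p.Pre → p.Pre) := by
  refine (AddMonoidHomClass.isometry_of_norm (starAddEquiv : p.Pre ≃+ p.Pre) ?_).uniformContinuous
  exact p.pre_norm_star

instance (p : CStarSeminorm A) : Star p.Completion where
  star := UniformSpace.Completion.map (star : p.Pre → p.Pre)

lemma continuous_star (p : CStarSeminorm A) :
    Continuous (star : p.Completion → p.Completion) :=
  UniformSpace.Completion.continuous_map

lemma ofAlgHom_star (p : CStarSeminorm A) (a : A) :
    p.ofAlgHom (star a) = star (p.ofAlgHom a) :=
  (UniformSpace.Completion.map_coe p.uniformContinuous_star (p.toPre a)).symm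

instance (p : CStarSeminorm A) : StarRing p.Completion where
  star_involutive x := by
    refine p.denseRange_ofAlgHom.induction_on (p := fun x => star (star x) = x) x
      (isClosed_eq (p.continuous_star.comp p.continuous_star) continuous_id) fun a => ?_
    rw [← ofAlgHom_star, ← ofAlgHom_star, star_star]
  star_mul x y := by
    refine p.denseRange_ofAlgHom.induction_on₂ (p := fun x y => star (x * y) = star y * star x)
      (isClosed_eq (p.continuous_star.comp continuous_mul)
        ((p.continuous_star.comp continuous_snd).mul (p.continuous_star.comp continuous_fst)))
      (fun a b => ?_) x y
    rw [← map_mul, ← ofAlgHom_star, ← ofAlgHom_star, ← ofAlgHom_star, star_mul, map_mul]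
  star_add x y := by
    refine p.denseRange_ofAlgHom.induction_on₂ (p := fun x y => star (x + y) = star x + star y)
      (isClosed_eq (p.continuous_star.comp continuous_add)
        ((p.continuous_star.comp continuous_fst).add (p.continuous_star.comp continuous_snd)))
      (fun a b => ?_) x y
    rw [← map_add, ← ofAlgHom_star, ← ofAlgHom_star, ← ofAlgHom_star, star_add, map_add]

/-- The completion of a `*`-algebra with respect to a C*-seminorm is a C*-algebra. -/
instance [StarModule ℂ A] (p : CStarSeminorm A) : CStarAlgebra p.Completion where
  norm_mul_self_le x := by
    refine p.denseRange_ofAlgHom.induction_on (p := fun x => ‖x‖ * ‖x‖ ≤ ‖star x * x‖) x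
      (isClosed_le (by fun_prop) ((p.continuous_star.mul continuous_id).norm)) fun a => ?_
    rw [← ofAlgHom_star, ← map_mul, norm_ofAlgHom, norm_ofAlgHom, p.star_mul_self, sq]
  star_smul c x := by
    refine p.denseRange_ofAlgHom.induction_on
      (p := fun x => star (c • x) = star c • star x) x
      (isClosed_eq (p.continuous_star.comp (continuous_const_smul c))
        (p.continuous_star.const_smul (star c))) fun a => ?_
    rw [← map_smul, ← ofAlgHom_star, ← ofAlgHom_star, star_smul, map_smul]

/-- The canonical `*`-homomorphism from `A` to its completion. -/
def of (p : CStarSeminorm A) : A →⋆ₐ[ℂ] p.Completion :=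
  { p.ofAlgHom with map_star' := p.ofAlgHom_star }

lemma norm_of (p : CStarSeminorm A) (a : A) : ‖p.of a‖ = p a := p.norm_ofAlgHom a

lemma denseRange_of (p : CStarSeminorm A) : DenseRange p.of := p.denseRange_ofAlgHom

/-- Auxiliary to `extend`: the continuous extension as a ring homomorphism. -/
def extendRingHom (p : CStarSeminorm A) {B : Type v} [CStarAlgebra B] (f : A →⋆ₐ[ℂ] B)
    (hf : ∀ a, ‖f a‖ ≤ p a) : p.Completion →+* B :=
  UniformSpace.Completion.extensionHom ((f : A →+* B).comp (p.toPre.symm : p.Pre →+* A))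
    (AddMonoidHomClass.continuous_of_bound _ 1 fun a => by
      rw [one_mul]; exact hf (p.toPre.symm a))

lemma continuous_extendRingHom (p : CStarSeminorm A) {B : Type v} [CStarAlgebra B]
    (f : A →⋆ₐ[ℂ] B) (hf : ∀ a, ‖f a‖ ≤ p a) : Continuous (p.extendRingHom f hf) :=
  UniformSpace.Completion.continuous_extension

lemma extendRingHom_of (p : CStarSeminorm A) {B : Type v} [CStarAlgebra B]
    (f : A →⋆ₐ[ℂ] B) (hf : ∀ a, ‖f a‖ ≤ p a) (a : A) : p.extendRingHom f hf (p.of a) = f a :=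
  UniformSpace.Completion.extensionHom_coe _ _ (p.toPre a)

/-- The extension by continuity, to the completion, of a `*`-homomorphism from `A` to a
C*-algebra that is contractive for `p`. -/
def extend (p : CStarSeminorm A) {B : Type v} [CStarAlgebra B] (f : A →⋆ₐ[ℂ] B)
    (hf : ∀ a, ‖f a‖ ≤ p a) : p.Completion →⋆ₐ[ℂ] B :=
  { p.extendRingHom f hf with
    commutes' := fun c => by
      have h := p.extendRingHom_of f hf (algebraMap ℂ A c)
      rw [AlgHomClass.commutes f, AlgHomClass.commutes p.of] at h
      exact h
    map_star' := fun x => by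
      refine p.denseRange_of.induction_on
        (p := fun x => p.extendRingHom f hf (star x) = star (p.extendRingHom f hf x)) x
        (isClosed_eq ((p.continuous_extendRingHom f hf).comp p.continuous_star)
          (p.continuous_extendRingHom f hf).star) fun a => ?_
      rw [← map_star, extendRingHom_of, extendRingHom_of, map_star] }

lemma extend_of (p : CStarSeminorm A) {B : Type v} [CStarAlgebra B] (f : A →⋆ₐ[ℂ] B)
    (hf : ∀ a, ‖f a‖ ≤ p a) (a : A) : p.extend f hf (p.of a) = f a :=
  p.extendRingHom_of f hf a

/-- The C*-seminorm `a ↦ ‖f a‖` defined by a `*`-homomorphism `f` to a C*-algebra. -/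
def ofStarAlgHom {B : Type v} [CStarAlgebra B] (f : A →⋆ₐ[ℂ] B) : CStarSeminorm A where
  toFun a := ‖f a‖
  map_zero' := by simp
  add_le' a b := by simpa using norm_add_le (f a) (f b)
  neg' a := by simp
  smul' c a := by simp [norm_smul]
  mul_le' a b := by simpa using norm_mul_le (f a) (f b)
  star_mul_self' a := by rw [map_mul, map_star, CStarRing.norm_star_mul_self, sq]

/-- The pointwise supremum of a nonempty pointwise bounded family of C*-seminorms. -/
def sup {ι : Sort v} [Nonempty ι] (p : ι → CStarSeminorm A)
    (hp : ∀ a, BddAbove (Set.range fun i => p i a)) : CStarSeminorm A where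
  toFun a := ⨆ i, p i a
  map_zero' := by simp [map_zero]
  add_le' a b := ciSup_le fun i => ((p i).add_le a b).trans
    (add_le_add (le_ciSup (hp a) i) (le_ciSup (hp b) i))
  neg' a := by
    congr 1; funext i; exact (p i).neg' a
  smul' c a := by
    rw [Real.mul_iSup_of_nonneg (norm_nonneg c)]
    congr 1; funext i; exact (p i).smul_eq c a
  mul_le' a b := ciSup_le fun i => ((p i).mul_le a b).trans
    (mul_le_mul (le_ciSup (hp a) i) (le_ciSup (hp b) i) ((p i).nonneg b)
      (((p i).nonneg a).trans (le_ciSup (hp a) i)))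
  star_mul_self' a := by
    have h0 : 0 ≤ ⨆ i, p i a := Real.iSup_nonneg fun i => (p i).nonneg a
    apply le_antisymm
    · refine ciSup_le fun i => ?_
      rw [(p i).star_mul_self]
      exact pow_le_pow_left₀ ((p i).nonneg a) (le_ciSup (hp a) i) 2
    · rw [← Real.le_sqrt h0 (Real.iSup_nonneg fun i => (p i).nonneg _)]
      refine ciSup_le fun i => Real.le_sqrt_of_sq_le ?_
      rw [← (p i).star_mul_self]
      exact le_ciSup (hp (star a * a)) i

lemma le_sup {ι : Sort v} [Nonempty ι] (p : ι → CStarSeminorm A)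
    (hp : ∀ a, BddAbove (Set.range fun i => p i a)) (i : ι) (a : A) : p i a ≤ sup p hp a :=
  le_ciSup (hp a) i

end CStarSeminorm

/-! ### Universal C*-algebras given by generators and relations -/

/-- The free unital complex `*`-algebra on `X`: noncommutative polynomials in the letters `x`,
written `(x, true)`, and their formal adjoints `x*`, written `(x, false)`. -/
def FreeStarAlgebra (X : Type u) : Type u := MonoidAlgebra ℂ (FreeMonoid (X × Bool))

namespace FreeStarAlgebra

variable {X : Type u}

instance : Ring (FreeStarAlgebra X) :=
  inferInstanceAs (Ring (MonoidAlgebra ℂ (FreeMonoid (X × Bool))))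
instance : Algebra ℂ (FreeStarAlgebra X) :=
  inferInstanceAs (Algebra ℂ (MonoidAlgebra ℂ (FreeMonoid (X × Bool))))

/-- The letter `y`, either a generator or the formal adjoint of one. -/
def letter (y : X × Bool) : FreeStarAlgebra X := MonoidAlgebra.single (FreeMonoid.of y) 1

/-- The generator `x`. -/
def gen (x : X) : FreeStarAlgebra X := letter (x, true)

/-- The algebra homomorphism with prescribed values on letters. -/
def liftLetters {B : Type v} [Ring B] [Algebra ℂ B] (f : X × Bool → B) :
    FreeStarAlgebra X →ₐ[ℂ] B :=
  MonoidAlgebra.lift ℂ B (FreeMonoid (X × Bool)) (FreeMonoid.lift f)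

lemma liftLetters_letter {B : Type v} [Ring B] [Algebra ℂ B] (f : X × Bool → B)
    (y : X × Bool) : liftLetters f (letter y) = f y :=
  (MonoidAlgebra.lift_single _ _ _).trans (by simp)

lemma induction {P : FreeStarAlgebra X → Prop} (a : FreeStarAlgebra X)
    (scalar : ∀ c : ℂ, P (algebraMap ℂ _ c)) (let_ : ∀ y, P (letter y))
    (add : ∀ a b, P a → P b → P (a + b)) (mul : ∀ a b, P a → P b → P (a * b)) : P a := by
  refine MonoidAlgebra.induction_linear a ?_ (fun x y hx hy => add x y hx hy) ?_
  · have h := scalar 0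
    rw [map_zero] at h
    exact h
  · intro w c
    have h : (MonoidAlgebra.single w c : MonoidAlgebra ℂ (FreeMonoid (X × Bool))) =
      MonoidAlgebra.single 1 c * MonoidAlgebra.single w 1 := by simp
    rw [h]
    refine mul _ _ (scalar c) ?_
    clear h
    induction w using FreeMonoid.inductionOn' with
    | one => exact scalar 1
    | of_mul y w ih =>
      have h : (MonoidAlgebra.single (FreeMonoid.of y * w) 1 :
          MonoidAlgebra ℂ (FreeMonoid (X × Bool))) =
        MonoidAlgebra.single (FreeMonoid.of y) 1 * MonoidAlgebra.single w 1 := by simp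
      rw [h]
      exact mul _ _ (let_ y) ih

open MulOpposite in
/-- The involution as a ring homomorphism to the opposite algebra: it conjugates scalars,
reverses words and exchanges `x` with `x*`. -/
def starHom : FreeStarAlgebra X →+* (FreeStarAlgebra X)ᵐᵒᵖ :=
  MonoidAlgebra.liftNCRingHom ((algebraMap ℂ (FreeStarAlgebra X)ᵐᵒᵖ).comp (starRingEnd ℂ))
    (FreeMonoid.lift fun y : X × Bool => op (letter (y.1, !y.2)))
    (fun c _ => Algebra.commutes ((starRingEnd ℂ) c) _)

open MulOpposite in
lemma starHom_single (w : FreeMonoid (X × Bool)) (c : ℂ) :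
    starHom (MonoidAlgebra.single w c : MonoidAlgebra ℂ (FreeMonoid (X × Bool))) =
      algebraMap ℂ (FreeStarAlgebra X)ᵐᵒᵖ ((starRingEnd ℂ) c) *
        FreeMonoid.lift (fun y : X × Bool => op (letter (y.1, !y.2))) w :=
  MonoidAlgebra.liftNC_single _ _ w c

instance : Star (FreeStarAlgebra X) := ⟨fun a => (starHom a).unop⟩

lemma star_letter (y : X × Bool) : star (letter y) = letter (y.1, !y.2) := by
  refine congrArg MulOpposite.unop ((starHom_single _ 1).trans ?_)
  rw [FreeMonoid.lift_eval_of, map_one, map_one, one_mul]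
  rfl

lemma star_algebraMap' (c : ℂ) :
    star (algebraMap ℂ (FreeStarAlgebra X) c) = algebraMap ℂ _ (star c) := by
  refine congrArg MulOpposite.unop ((starHom_single 1 c).trans ?_)
  rw [map_one, mul_one]
  rfl

instance : StarRing (FreeStarAlgebra X) where
  star_add a b := congrArg MulOpposite.unop (map_add starHom a b)
  star_mul a b := congrArg MulOpposite.unop (map_mul starHom a b)
  star_involutive a := by
    have hadd : ∀ a b : FreeStarAlgebra X, star (a + b) = star a + star b := fun a b =>
      congrArg MulOpposite.unop (map_add starHom a b)
    have hmul : ∀ a b : FreeStarAlgebra X, star (a * b) = star b * star a := fun a b =>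
      congrArg MulOpposite.unop (map_mul starHom a b)
    induction a using induction with
    | scalar c => rw [star_algebraMap', star_algebraMap', star_star]
    | let_ y => rw [star_letter, star_letter]; simp
    | add a b ha hb => rw [hadd, hadd, ha, hb]
    | mul a b ha hb => rw [hmul, hmul, ha, hb]

instance : StarModule ℂ (FreeStarAlgebra X) where
  star_smul c a := by
    rw [Algebra.smul_def, star_mul, star_algebraMap', Algebra.smul_def, Algebra.commutes]

/-- The `*`-homomorphism from the free `*`-algebra with prescribed values on generators. -/
def lift {B : Type v} [Ring B] [StarRing B] [Algebra ℂ B] [StarModule ℂ B] (f : X → B) :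
    FreeStarAlgebra X →⋆ₐ[ℂ] B :=
  { liftLetters (fun y : X × Bool => bif y.2 then f y.1 else star (f y.1)) with
    map_star' := fun a => by
      change liftLetters _ (star a) = star (liftLetters _ a)
      induction a using induction with
      | scalar c =>
        rw [star_algebraMap', AlgHomClass.commutes, AlgHomClass.commutes, algebraMap_star_comm]
      | let_ y =>
        rw [star_letter, liftLetters_letter, liftLetters_letter]
        rcases y with ⟨x, _ | _⟩ <;> simp
      | add a b ha hb => rw [star_add, map_add, map_add, star_add, ha, hb]
      | mul a b ha hb => rw [star_mul, map_mul, map_mul, star_mul, ha, hb] }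

lemma lift_gen {B : Type v} [Ring B] [StarRing B] [Algebra ℂ B] [StarModule ℂ B] (f : X → B)
    (x : X) : lift f (gen x) = f x :=
  liftLetters_letter _ (x, true)

end FreeStarAlgebra

/-- The C*-seminorms on the free `*`-algebra in which the relations `a = b`, for `R a b`, hold. -/
def AdmissibleSeminorm {X : Type u} (R : FreeStarAlgebra X → FreeStarAlgebra X → Prop) : Type u :=
  {p : CStarSeminorm (FreeStarAlgebra X) // ∀ a b, R a b → p (a - b) = 0}

/-- The relations bound every polynomial uniformly over all admissible C*-seminorms; this is the
condition under which the universal C*-algebra exists. -/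
class BoundedRelations {X : Type u} (R : FreeStarAlgebra X → FreeStarAlgebra X → Prop) :
    Prop where
  bddAbove : ∀ a, BddAbove (Set.range fun p : AdmissibleSeminorm R => p.1 a)

section Universal

variable {X : Type u} (R : FreeStarAlgebra X → FreeStarAlgebra X → Prop)

instance : Nonempty (AdmissibleSeminorm R) :=
  ⟨⟨{ (0 : Seminorm ℂ (FreeStarAlgebra X)) with
      mul_le' := fun _ _ => (mul_zero (0 : ℝ)).ge
      star_mul_self' := fun _ => (zero_pow two_ne_zero).symm }, fun _ _ _ => rfl⟩⟩

/-- It suffices to bound the generators. -/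
lemma BoundedRelations.of_gen (C : X → ℝ)
    (h : ∀ (p : AdmissibleSeminorm R) (x : X), p.1 (FreeStarAlgebra.gen x) ≤ C x) :
    BoundedRelations R where
  bddAbove a := by
    suffices H : ∃ D, ∀ p : AdmissibleSeminorm R, p.1 a ≤ D by
      obtain ⟨D, hD⟩ := H
      exact ⟨D, by rintro _ ⟨p, rfl⟩; exact hD p⟩
    induction a using FreeStarAlgebra.induction with
    | scalar c =>
      refine ⟨‖c‖ * 1, fun p => ?_⟩
      rw [Algebra.algebraMap_eq_smul_one, p.1.smul_eq]
      exact mul_le_mul_of_nonneg_left p.1.one_le (norm_nonneg c)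
    | let_ y =>
      refine ⟨C y.1, fun p => ?_⟩
      rcases y with ⟨x, _ | _⟩
      · have h1 : FreeStarAlgebra.letter (x, false) = star (FreeStarAlgebra.gen x) :=
          (FreeStarAlgebra.star_letter (x, true)).symm
        rw [h1, p.1.star_eq]
        exact h p x
      · exact h p x
    | add a b ha hb =>
      obtain ⟨D, hD⟩ := ha
      obtain ⟨E, hE⟩ := hb
      exact ⟨D + E, fun p => (p.1.add_le a b).trans (add_le_add (hD p) (hE p))⟩
    | mul a b ha hb =>
      obtain ⟨D, hD⟩ := ha
      obtain ⟨E, hE⟩ := hb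
      exact ⟨D * E, fun p => (p.1.mul_le a b).trans
        (mul_le_mul (hD p) (hE p) (p.1.nonneg b) ((p.1.nonneg a).trans (hD p)))⟩

variable [BoundedRelations R]

/-- The largest C*-seminorm in which the relations hold. -/
def universalSeminorm : CStarSeminorm (FreeStarAlgebra X) :=
  CStarSeminorm.sup (fun p : AdmissibleSeminorm R => p.1) BoundedRelations.bddAbove

/-- The universal unital C*-algebra with generators `X` and relations `a = b` for `R a b`: the
completion of the free `*`-algebra in the largest C*-seminorm in which the relations hold. -/
def UniversalCStarAlgebra : Type u := (universalSeminorm R).Completion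

namespace UniversalCStarAlgebra

instance : CStarAlgebra (UniversalCStarAlgebra R) :=
  inferInstanceAs (CStarAlgebra (universalSeminorm R).Completion)

/-- The class of a polynomial in the universal C*-algebra. -/
def mk : FreeStarAlgebra X →⋆ₐ[ℂ] UniversalCStarAlgebra R := (universalSeminorm R).of

/-- The generators of the universal C*-algebra. -/
def gen (x : X) : UniversalCStarAlgebra R := mk R (FreeStarAlgebra.gen x)

lemma mk_rel {a b : FreeStarAlgebra X} (h : R a b) : mk R a = mk R b := by
  rw [← sub_eq_zero, ← map_sub, ← norm_eq_zero]
  refine ((universalSeminorm R).norm_of (a - b)).trans (le_antisymm ?_ (CStarSeminorm.nonneg _ _))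
  exact ciSup_le fun p => (p.2 a b h).le

/-- The `*`-homomorphism to a C*-algebra `B` determined by a family of elements of `B` that
satisfies the relations. -/
def lift {B : Type v} [CStarAlgebra B] (f : X → B)
    (hf : ∀ a b, R a b → FreeStarAlgebra.lift f a = FreeStarAlgebra.lift f b) :
    UniversalCStarAlgebra R →⋆ₐ[ℂ] B :=
  (universalSeminorm R).extend (FreeStarAlgebra.lift f) fun a =>
    CStarSeminorm.le_sup (fun p : AdmissibleSeminorm R => p.1) BoundedRelations.bddAbove
      ⟨CStarSeminorm.ofStarAlgHom (FreeStarAlgebra.lift f), fun a b h => by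
        change ‖FreeStarAlgebra.lift f (a - b)‖ = 0
        rw [map_sub, hf a b h, sub_self, norm_zero]⟩ a

lemma lift_gen {B : Type v} [CStarAlgebra B] (f : X → B)
    (hf : ∀ a b, R a b → FreeStarAlgebra.lift f a = FreeStarAlgebra.lift f b) (x : X) :
    lift R f hf (gen R x) = f x :=
  (CStarSeminorm.extend_of _ _ _ _).trans (FreeStarAlgebra.lift_gen f x)

end UniversalCStarAlgebra

end Universal

/-! ### The minimal tensor product -/

/-- A pair consisting of unital `*`-representations of `A` and of `B` on Hilbert spaces. -/
structure RepPair (A B : Type u) [CStarAlgebra A] [CStarAlgebra B] where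
  H : Type u
  K : Type u
  [instH₁ : NormedAddCommGroup H]
  [instH₂ : InnerProductSpace ℂ H]
  [instH₃ : CompleteSpace H]
  [instK₁ : NormedAddCommGroup K]
  [instK₂ : InnerProductSpace ℂ K]
  [instK₃ : CompleteSpace K]
  π : A →⋆ₐ[ℂ] (H →L[ℂ] H)
  ρ : B →⋆ₐ[ℂ] (K →L[ℂ] K)

namespace RepPair

attribute [instance] instH₁ instH₂ instH₃ instK₁ instK₂ instK₃

variable {A B : Type u} [CStarAlgebra A] [CStarAlgebra B]

/-- The representation `π ⊗ ρ` of the algebraic tensor product `A ⊗ B`, by bounded operators on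
the algebraic tensor product of the two Hilbert spaces with its inner product (these operators
have the same norms as their extensions to the Hilbert space tensor product). -/
def tensor (r : RepPair A B) : A ⊗[ℂ] B →ₐ[ℂ] (r.H ⊗[ℂ] r.K →L[ℂ] r.H ⊗[ℂ] r.K) :=
  Algebra.TensorProduct.algHomOfLinearMapTensorProduct
    (TensorProduct.lift (LinearMap.mk₂ ℂ (fun a b => TensorProduct.mapL (r.π a) (r.ρ b))
      (fun a a' b => by rw [map_add, TensorProduct.mapL_add_left])
      (fun c a b => by rw [map_smul, TensorProduct.mapL_smul_left])
      (fun a b b' => by rw [map_add, TensorProduct.mapL_add_right])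
      (fun c a b => by rw [map_smul, TensorProduct.mapL_smul_right])))
    (fun a a' b b' => by
      simp only [TensorProduct.lift.tmul, LinearMap.mk₂_apply, map_mul]
      exact TensorProduct.mapL_mul _ _ _ _)
    (by
      simp only [TensorProduct.lift.tmul, LinearMap.mk₂_apply, map_one]
      exact TensorProduct.mapL_id_id)

lemma tensor_tmul (r : RepPair A B) (a : A) (b : B) :
    r.tensor (a ⊗ₜ b) = TensorProduct.mapL (r.π a) (r.ρ b) := rfl

lemma inner_tensor (r : RepPair A B) (x : A ⊗[ℂ] B) (v w : r.H ⊗[ℂ] r.K) :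
    inner ℂ (r.tensor x v) w = inner ℂ v (r.tensor (star x) w) := by
  induction x using TensorProduct.induction_on with
  | zero => simp
  | add x y hx hy => simp only [map_add, star_add, add_apply, inner_add_left,
      inner_add_right, hx, hy]
  | tmul a b =>
    rw [TensorProduct.star_tmul, tensor_tmul, tensor_tmul, map_star, map_star]
    induction v using TensorProduct.induction_on with
    | zero => simp
    | add x y hx hy => rw [map_add, inner_add_left, inner_add_left, hx, hy]
    | tmul h k =>
      induction w using TensorProduct.induction_on with
      | zero => simp
      | add x y hx hy => rw [map_add, inner_add_right, inner_add_right, hx, hy]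
      | tmul h' k' =>
        rw [TensorProduct.mapL_tmul, TensorProduct.mapL_tmul, TensorProduct.inner_tmul,
          TensorProduct.inner_tmul, ContinuousLinearMap.star_eq_adjoint,
          ContinuousLinearMap.star_eq_adjoint, ContinuousLinearMap.adjoint_inner_right,
          ContinuousLinearMap.adjoint_inner_right]

lemma sq_norm_tensor_le (r : RepPair A B) (x : A ⊗[ℂ] B) :
    ‖r.tensor x‖ ^ 2 ≤ ‖r.tensor (star x * x)‖ := by
  refine (Real.le_sqrt (norm_nonneg (r.tensor x)) (norm_nonneg (r.tensor (star x * x)))).mp ?_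
  refine ContinuousLinearMap.opNorm_le_bound _ (Real.sqrt_nonneg _) fun v => ?_
  refine le_of_sq_le_sq ?_ (by positivity)
  rw [mul_pow, Real.sq_sqrt (norm_nonneg (r.tensor (star x * x)))]
  have h : ‖r.tensor x v‖ ^ 2 = RCLike.re (inner ℂ v (r.tensor (star x * x) v)) := by
    rw [← inner_self_eq_norm_sq (𝕜 := ℂ), inner_tensor, map_mul]
    rfl
  rw [h]
  calc RCLike.re (inner ℂ v (r.tensor (star x * x) v))
      ≤ ‖v‖ * ‖r.tensor (star x * x) v‖ :=
        re_inner_le_norm (𝕜 := ℂ) v (r.tensor (star x * x) v)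
    _ ≤ ‖v‖ * (‖r.tensor (star x * x)‖ * ‖v‖) := by
        gcongr; exact ContinuousLinearMap.le_opNorm _ _
    _ = _ := by ring

/-- The C*-seminorm `x ↦ ‖(π ⊗ ρ)(x)‖` on the algebraic tensor product. -/
def seminorm (r : RepPair A B) : CStarSeminorm (A ⊗[ℂ] B) where
  toSeminorm := Seminorm.ofSMulLE (fun x => ‖r.tensor x‖)
    ((congrArg norm (_root_.map_zero r.tensor)).trans ContinuousLinearMap.opNorm_zero)
    (fun x y => by simpa using norm_add_le (r.tensor x) (r.tensor y))
    (fun c x => (congrArg norm (map_smul r.tensor c x)).trans_le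
      (ContinuousLinearMap.opNorm_smul_le c (r.tensor x)))
  mul_le' x y := (congrArg norm (map_mul r.tensor x y)).trans_le
    (norm_mul_le (r.tensor x) (r.tensor y))
  star_mul_self' x := by
    have key : ∀ y, ‖r.tensor (star y * y)‖ ≤ ‖r.tensor (star y)‖ * ‖r.tensor y‖ := fun y => by
      simpa using norm_mul_le (r.tensor (star y)) (r.tensor y)
    have hle : ∀ y, ‖r.tensor y‖ ≤ ‖r.tensor (star y)‖ := fun y => by
      by_contra! h
      nlinarith [key y, r.sq_norm_tensor_le y, norm_nonneg (r.tensor (star y))]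
    have heq : ‖r.tensor (star x)‖ = ‖r.tensor x‖ :=
      le_antisymm (by simpa using hle (star x)) (hle x)
    change ‖r.tensor (star x * x)‖ = ‖r.tensor x‖ ^ 2
    refine le_antisymm ?_ (r.sq_norm_tensor_le x)
    rw [sq]
    exact (key x).trans_eq (by rw [heq])

lemma bddAbove (x : A ⊗[ℂ] B) :
    BddAbove (Set.range fun r : RepPair A B => r.seminorm x) := by
  suffices H : ∃ D, ∀ r : RepPair A B, r.seminorm x ≤ D by
    obtain ⟨D, hD⟩ := H
    exact ⟨D, by rintro _ ⟨r, rfl⟩; exact hD r⟩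
  induction x using TensorProduct.induction_on with
  | zero => exact ⟨0, fun r => r.seminorm.map_zero.le⟩
  | tmul a b =>
    refine ⟨‖a‖ * ‖b‖, fun r => ?_⟩
    refine (TensorProduct.norm_mapL_le (r.π a) (r.ρ b)).trans ?_
    exact mul_le_mul (NonUnitalStarAlgHom.norm_apply_le r.π a)
      (NonUnitalStarAlgHom.norm_apply_le r.ρ b) (norm_nonneg _) (norm_nonneg _)
  | add x y hx hy =>
    obtain ⟨D, hD⟩ := hx
    obtain ⟨E, hE⟩ := hy
    exact ⟨D + E, fun r => (r.seminorm.add_le x y).trans (add_le_add (hD r) (hE r))⟩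

instance : Nonempty (RepPair A B) :=
  ⟨{ H := PUnit
     K := PUnit
     π := { toFun := fun _ => 0, map_one' := Subsingleton.elim _ _,
            map_mul' := fun _ _ => Subsingleton.elim _ _, map_zero' := rfl,
            map_add' := fun _ _ => Subsingleton.elim _ _,
            commutes' := fun _ => Subsingleton.elim _ _,
            map_star' := fun _ => Subsingleton.elim _ _ }
     ρ := { toFun := fun _ => 0, map_one' := Subsingleton.elim _ _,
            map_mul' := fun _ _ => Subsingleton.elim _ _, map_zero' := rfl,
            map_add' := fun _ _ => Subsingleton.elim _ _,
            commutes' := fun _ => Subsingleton.elim _ _,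
            map_star' := fun _ => Subsingleton.elim _ _ } }⟩

/-- The restriction of a pair of representations along `*`-homomorphisms. -/
def comp {A' B' : Type u} [CStarAlgebra A'] [CStarAlgebra B'] (r : RepPair A' B')
    (f : A →⋆ₐ[ℂ] A') (g : B →⋆ₐ[ℂ] B') : RepPair A B where
  H := r.H
  K := r.K
  π := r.π.comp f
  ρ := r.ρ.comp g

end RepPair

section MinTensor

variable (A B : Type u) [CStarAlgebra A] [CStarAlgebra B]

/-- The minimal (spatial) C*-norm on the algebraic tensor product: the supremum of
`‖(π ⊗ ρ)(x)‖` over all pairs of representations `π` of `A` and `ρ` of `B`. -/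
def minSeminorm : CStarSeminorm (A ⊗[ℂ] B) :=
  CStarSeminorm.sup (fun r : RepPair A B => r.seminorm) RepPair.bddAbove

/-- The minimal tensor product of two unital C*-algebras. -/
def MinTensor : Type u := (minSeminorm A B).Completion

instance : CStarAlgebra (MinTensor A B) :=
  inferInstanceAs (CStarAlgebra (minSeminorm A B).Completion)

end MinTensor

namespace MinTensor

variable {A B : Type u} [CStarAlgebra A] [CStarAlgebra B]

/-- The canonical `*`-homomorphism from the algebraic to the minimal tensor product. -/
def ofTensor : A ⊗[ℂ] B →⋆ₐ[ℂ] MinTensor A B := (minSeminorm A B).of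

/-- The elementary tensor `a ⊗ b`. -/
def tmul (a : A) (b : B) : MinTensor A B := ofTensor (a ⊗ₜ b)

lemma tmul_mul (a a' : A) (b b' : B) : tmul a b * tmul a' b' = tmul (a * a') (b * b') := by
  simp only [tmul, ← map_mul, Algebra.TensorProduct.tmul_mul_tmul]
lemma star_tmul (a : A) (b : B) : star (tmul a b) = tmul (star a) (star b) := by
  simp only [tmul, ← map_star, TensorProduct.star_tmul]
lemma one_tmul_one : tmul (1 : A) (1 : B) = 1 := map_one ofTensor
lemma zero_tmul (b : B) : tmul (0 : A) b = 0 := by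
  simp only [tmul, TensorProduct.zero_tmul, map_zero]
lemma tmul_zero (a : A) : tmul a (0 : B) = 0 := by
  simp only [tmul, TensorProduct.tmul_zero, map_zero]
lemma sum_tmul {ι : Type w} (s : Finset ι) (f : ι → A) (b : B) :
    tmul (∑ i ∈ s, f i) b = ∑ i ∈ s, tmul (f i) b := by
  simp only [tmul, TensorProduct.sum_tmul, map_sum]
lemma tmul_sum {ι : Type w} (s : Finset ι) (a : A) (f : ι → B) :
    tmul a (∑ i ∈ s, f i) = ∑ i ∈ s, tmul a (f i) := by
  simp only [tmul, TensorProduct.tmul_sum, map_sum]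

/-- The `*`-homomorphism `f ⊗ g` between algebraic tensor products. -/
def algMap {A' B' : Type u} [CStarAlgebra A'] [CStarAlgebra B']
    (f : A →⋆ₐ[ℂ] A') (g : B →⋆ₐ[ℂ] B') : A ⊗[ℂ] B →⋆ₐ[ℂ] A' ⊗[ℂ] B' :=
  { Algebra.TensorProduct.map (f : A →ₐ[ℂ] A') (g : B →ₐ[ℂ] B') with
    map_star' := fun x => by
      change Algebra.TensorProduct.map (f : A →ₐ[ℂ] A') (g : B →ₐ[ℂ] B') (star x) =
        star (Algebra.TensorProduct.map (f : A →ₐ[ℂ] A') (g : B →ₐ[ℂ] B') x)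
      induction x using TensorProduct.induction_on with
      | zero => simp
      | tmul a b => simp [map_star]
      | add x y hx hy => rw [star_add, map_add, map_add, star_add, hx, hy] }

lemma algMap_tmul {A' B' : Type u} [CStarAlgebra A'] [CStarAlgebra B']
    (f : A →⋆ₐ[ℂ] A') (g : B →⋆ₐ[ℂ] B') (a : A) (b : B) :
    algMap f g (a ⊗ₜ b) = f a ⊗ₜ g b := rfl

lemma tensor_comp {A' B' : Type u} [CStarAlgebra A'] [CStarAlgebra B'] (r : RepPair A' B')
    (f : A →⋆ₐ[ℂ] A') (g : B →⋆ₐ[ℂ] B') (x : A ⊗[ℂ] B) :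
    (r.comp f g).tensor x = r.tensor (algMap f g x) := by
  induction x using TensorProduct.induction_on with
  | zero => simp only [map_zero]; rfl
  | tmul a b => rfl
  | add x y hx hy => rw [map_add, map_add, map_add, ← hx, ← hy]; rfl

/-- The `*`-homomorphism `f ⊗ g` between minimal tensor products. -/
def map {A' B' : Type u} [CStarAlgebra A'] [CStarAlgebra B']
    (f : A →⋆ₐ[ℂ] A') (g : B →⋆ₐ[ℂ] B') : MinTensor A B →⋆ₐ[ℂ] MinTensor A' B' :=
  (minSeminorm A B).extend (ofTensor.comp (algMap f g)) fun x => by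
    rw [StarAlgHom.comp_apply]
    refine ((minSeminorm A' B').norm_of _).trans_le (ciSup_le fun r => ?_)
    refine le_trans ?_ (CStarSeminorm.le_sup (fun r : RepPair A B => r.seminorm) RepPair.bddAbove
      (r.comp f g) x)
    exact (congrArg norm (tensor_comp r f g x)).ge

lemma map_tmul {A' B' : Type u} [CStarAlgebra A'] [CStarAlgebra B']
    (f : A →⋆ₐ[ℂ] A') (g : B →⋆ₐ[ℂ] B') (a : A) (b : B) :
    map f g (tmul a b) = tmul (f a) (g b) :=
  CStarSeminorm.extend_of _ _ _ _

end MinTensor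

/-! ### The full group C*-algebra and the dual of a discrete group -/

/-- The relations of the full group C*-algebra, between generators `u_g` indexed by `g : Γ`. -/
inductive GroupRel (Γ : Type u) [Group Γ] : FreeStarAlgebra Γ → FreeStarAlgebra Γ → Prop
  | star_mul_self (g : Γ) :
      GroupRel Γ (star (FreeStarAlgebra.gen g) * FreeStarAlgebra.gen g) 1
  | mul_star_self (g : Γ) :
      GroupRel Γ (FreeStarAlgebra.gen g * star (FreeStarAlgebra.gen g)) 1
  | mul (g h : Γ) :
      GroupRel Γ (FreeStarAlgebra.gen (g * h)) (FreeStarAlgebra.gen g * FreeStarAlgebra.gen h)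
  | inv (g : Γ) :
      GroupRel Γ (FreeStarAlgebra.gen g⁻¹) (star (FreeStarAlgebra.gen g))

instance (Γ : Type u) [Group Γ] : BoundedRelations (GroupRel Γ) :=
  .of_gen _ (fun _ => 1) fun p g => by
    have h1 := p.2 _ _ (GroupRel.star_mul_self g)
    have h2 := p.1.add_le
      (star (FreeStarAlgebra.gen g) * FreeStarAlgebra.gen g - 1) (1 : FreeStarAlgebra Γ)
    rw [sub_add_cancel, p.1.star_mul_self, h1] at h2
    nlinarith [p.1.one_le, p.1.nonneg (FreeStarAlgebra.gen g)]

/-- The full group C*-algebra `C*(Γ)` of a discrete group `Γ`. -/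
abbrev GroupCStarAlgebra (Γ : Type u) [Group Γ] : Type u := UniversalCStarAlgebra (GroupRel Γ)

namespace GroupCStarAlgebra

variable {Γ : Type u} [Group Γ]

/-- The canonical unitary `u_g` in `C*(Γ)`. -/
def u (g : Γ) : GroupCStarAlgebra Γ := UniversalCStarAlgebra.gen (GroupRel Γ) g

lemma star_u_mul_u (g : Γ) : star (u g) * u g = 1 := by
  have h := UniversalCStarAlgebra.mk_rel _ (GroupRel.star_mul_self g)
  rwa [map_mul, map_star, map_one] at h
lemma u_mul_star_u (g : Γ) : u g * star (u g) = 1 := by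
  have h := UniversalCStarAlgebra.mk_rel _ (GroupRel.mul_star_self g)
  rwa [map_mul, map_star, map_one] at h
lemma u_mul (g h : Γ) : u (g * h) = u g * u h := by
  have h := UniversalCStarAlgebra.mk_rel _ (GroupRel.mul g h)
  rwa [map_mul] at h
lemma u_inv (g : Γ) : u g⁻¹ = star (u g) := by
  have h := UniversalCStarAlgebra.mk_rel _ (GroupRel.inv g)
  rwa [map_star] at h

/-- The coproduct `Δ_Γ : C*(Γ) → C*(Γ) ⊗ C*(Γ)`, `u_g ↦ u_g ⊗ u_g`. -/
def comul : GroupCStarAlgebra Γ →⋆ₐ[ℂ] MinTensor (GroupCStarAlgebra Γ) (GroupCStarAlgebra Γ) :=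
  UniversalCStarAlgebra.lift _ (fun g => MinTensor.tmul (u g) (u g)) fun a b h => by
    cases h with
    | star_mul_self g =>
      rw [map_mul, map_star, map_one, FreeStarAlgebra.lift_gen, MinTensor.star_tmul,
        MinTensor.tmul_mul, star_u_mul_u, MinTensor.one_tmul_one]
    | mul_star_self g =>
      rw [map_mul, map_star, map_one, FreeStarAlgebra.lift_gen, MinTensor.star_tmul,
        MinTensor.tmul_mul, u_mul_star_u, MinTensor.one_tmul_one]
    | mul g h =>
      rw [map_mul, FreeStarAlgebra.lift_gen, FreeStarAlgebra.lift_gen, FreeStarAlgebra.lift_gen,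
        MinTensor.tmul_mul, u_mul]
    | inv g =>
      rw [map_star, FreeStarAlgebra.lift_gen, FreeStarAlgebra.lift_gen, MinTensor.star_tmul, u_inv]

lemma comul_u (g : Γ) : comul (u g) = MinTensor.tmul (u g) (u g) :=
  UniversalCStarAlgebra.lift_gen _ _ _ g

end GroupCStarAlgebra

/-! ### Colored graphs and their quantum automorphism groups -/

/-- A vertex- and edge-colored simple graph, with vertex colors in `C` and edge colors in `D`. -/
structure ColoredGraph (V : Type u) (C : Type v) (D : Type w) where
  graph : SimpleGraph V
  vertexColor : V → C
  edgeColor : graph.edgeSet → D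

namespace ColoredGraph

variable {V : Type u} {C : Type v} {D : Type w}

open Classical in
/-- The `(i, j)` entry, in a ring `R`, of the adjacency matrix `A_{G_d}` of the edges of
color `d`. -/
def adjMatrix (G : ColoredGraph V C D) (d : D) (R : Type*) [Zero R] [One R] (i j : V) : R :=
  if ∃ h : s(i, j) ∈ G.graph.edgeSet, G.edgeColor ⟨s(i, j), h⟩ = d then 1 else 0

lemma map_adjMatrix (G : ColoredGraph V C D) {A B F : Type*} [Ring A] [Ring B] [FunLike F A B] [RingHomClass F A B]
    (f : F) (d : D) (i j : V) :
    f (G.adjMatrix d A i j) = G.adjMatrix d B i j := by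
  unfold adjMatrix
  split_ifs <;> simp

/-- The defining relations of `C(Qut(G))`, between generators `u_{ij}` indexed by pairs of
vertices. -/
inductive QutRel [Fintype V] (G : ColoredGraph V C D) :
    FreeStarAlgebra (V × V) → FreeStarAlgebra (V × V) → Prop
  | selfAdjoint (i j : V) : QutRel G (star (FreeStarAlgebra.gen (i, j))) (FreeStarAlgebra.gen (i, j))
  | sq (i j : V) : QutRel G (FreeStarAlgebra.gen (i, j) ^ 2) (FreeStarAlgebra.gen (i, j))
  | row (i : V) : QutRel G (∑ l, FreeStarAlgebra.gen (i, l)) 1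
  | col (i : V) : QutRel G (∑ l, FreeStarAlgebra.gen (l, i)) 1
  | color (i j : V) (h : G.vertexColor i ≠ G.vertexColor j) :
      QutRel G (FreeStarAlgebra.gen (i, j)) 0
  | adj (d : D) (i j : V) :
      QutRel G (∑ k, FreeStarAlgebra.gen (i, k) * G.adjMatrix d (FreeStarAlgebra (V × V)) k j)
        (∑ k, G.adjMatrix d (FreeStarAlgebra (V × V)) i k * FreeStarAlgebra.gen (k, j))

variable [Fintype V] (G : ColoredGraph V C D)

instance : BoundedRelations G.QutRel :=
  .of_gen _ (fun _ => 1) fun p x => by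
    set a : FreeStarAlgebra (V × V) := FreeStarAlgebra.gen x with ha
    have h1 : p.1 (a - star a) = 0 := by
      have h := p.2 _ _ (QutRel.selfAdjoint x.1 x.2)
      have h' := p.1.smul_eq (-1) (star a - a)
      rw [neg_one_smul, neg_sub] at h'
      rw [h']
      exact mul_eq_zero_of_right _ h
    have h2 : p.1 (a ^ 2 - a) = 0 := p.2 _ _ (QutRel.sq x.1 x.2)
    have h3 : star a * a = (a ^ 2 - a) + (a + (-1 : ℂ) • ((a - star a) * a)) := by
      rw [neg_one_smul, sub_mul, sq]; abel
    have h4 := p.1.star_mul_self a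
    have h5 := p.1.add_le (a ^ 2 - a) (a + (-1 : ℂ) • ((a - star a) * a))
    have h6 := p.1.add_le a ((-1 : ℂ) • ((a - star a) * a))
    have h7 := p.1.mul_le (a - star a) a
    rw [h1, zero_mul] at h7
    rw [p.1.smul_eq, norm_neg, norm_one, one_mul] at h6
    rw [← h3, h4, h2] at h5
    by_contra! hlt
    nlinarith [p.1.nonneg a]

/-- The C*-algebra `C(Qut(G))` of the quantum automorphism group of `G`. -/
abbrev QutAlgebra : Type u := UniversalCStarAlgebra G.QutRel

/-- The entry `u_{ij}` of the fundamental representation of `Qut(G)`. -/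
def u (i j : V) : G.QutAlgebra := UniversalCStarAlgebra.gen G.QutRel (i, j)

lemma star_u (i j : V) : star (G.u i j) = G.u i j := by
  have h := UniversalCStarAlgebra.mk_rel _ (QutRel.selfAdjoint (G := G) i j)
  rwa [map_star] at h

lemma u_mul_self (i j : V) : G.u i j * G.u i j = G.u i j := by
  have h := UniversalCStarAlgebra.mk_rel _ (QutRel.sq (G := G) i j)
  rwa [map_pow, sq] at h

lemma sum_row (i : V) : ∑ l, G.u i l = 1 := by
  have h := UniversalCStarAlgebra.mk_rel _ (QutRel.row (G := G) i)
  rwa [map_sum, map_one] at h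

lemma sum_col (i : V) : ∑ l, G.u l i = 1 := by
  have h := UniversalCStarAlgebra.mk_rel _ (QutRel.col (G := G) i)
  rwa [map_sum, map_one] at h

lemma u_color (i j : V) (h : G.vertexColor i ≠ G.vertexColor j) : G.u i j = 0 := by
  have h := UniversalCStarAlgebra.mk_rel _ (QutRel.color (G := G) i j h)
  rwa [map_zero] at h

lemma u_adj (d : D) (i j : V) :
    ∑ k, G.u i k * G.adjMatrix d G.QutAlgebra k j =
      ∑ k, G.adjMatrix d G.QutAlgebra i k * G.u k j := by
  have h := UniversalCStarAlgebra.mk_rel _ (QutRel.adj (G := G) d i j)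
  simp only [map_sum, map_mul] at h
  have h2 : ∀ i j, UniversalCStarAlgebra.mk G.QutRel
      (G.adjMatrix d (FreeStarAlgebra (V × V)) i j) = G.adjMatrix d G.QutAlgebra i j :=
    fun i j => G.map_adjMatrix (UniversalCStarAlgebra.mk G.QutRel) d i j
  simp only [h2] at h
  exact h

end ColoredGraph

/-- Projections in a C*-algebra that add up to `1` are pairwise orthogonal. -/
lemma mul_eq_zero_of_sum_projections {B : Type v} [CStarAlgebra B] {ι : Type u} [Fintype ι]
    (q : ι → B) (hs : ∀ i, star (q i) = q i) (hq : ∀ i, q i * q i = q i) (h1 : ∑ i, q i = 1)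
    {i j : ι} (hij : i ≠ j) : q i * q j = 0 := by
  classical
  let _ := CStarAlgebra.spectralOrder B
  have _ := CStarAlgebra.spectralOrderedRing B
  have h2 : ∑ k ∈ Finset.univ.erase j, star (q k * q j) * (q k * q j) = 0 := by
    have h3 : ∑ k, star (q k * q j) * (q k * q j) = q j := by
      have : ∀ k, star (q k * q j) * (q k * q j) = q j * q k * q j := fun k => by
        rw [star_mul, hs, hs, mul_assoc, ← mul_assoc (q k), hq, mul_assoc]
      simp only [this]
      rw [← Finset.sum_mul, ← Finset.mul_sum, h1, mul_one, hq]
    rw [← Finset.add_sum_erase _ _ (Finset.mem_univ j), hq, hs, hq] at h3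
    simpa using h3
  have h3 := (Finset.sum_eq_zero_iff_of_nonneg fun k _ => star_mul_self_nonneg (q k * q j)).mp h2 i
    (Finset.mem_erase.mpr ⟨hij, Finset.mem_univ i⟩)
  exact CStarRing.star_mul_self_eq_zero_iff _ |>.mp h3

namespace ColoredGraph

variable {V : Type u} {C : Type v} {D : Type w} [Fintype V] (G : ColoredGraph V C D)

open Classical in
lemma u_mul_u_row (i k l : V) : G.u i k * G.u i l = if k = l then G.u i k else 0 := by
  split_ifs with h
  · rw [← h, u_mul_self]
  · exact mul_eq_zero_of_sum_projections (G.u i) (G.star_u i) (G.u_mul_self i) (G.sum_row i) h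

/-- The elements `∑_b u_{ab} ⊗ u_{bc}`. -/
def comulEntry (a c : V) : MinTensor G.QutAlgebra G.QutAlgebra :=
  ∑ b, MinTensor.tmul (G.u a b) (G.u b c)

lemma tmul_adjMatrix (d : D) (i j : V) (x y : G.QutAlgebra) :
    MinTensor.tmul x y * G.adjMatrix d (MinTensor G.QutAlgebra G.QutAlgebra) i j =
      MinTensor.tmul x (y * G.adjMatrix d G.QutAlgebra i j) := by
  unfold adjMatrix
  split_ifs
  · rw [mul_one, mul_one]
  · rw [mul_zero, mul_zero, MinTensor.tmul_zero]

lemma adjMatrix_tmul (d : D) (i j : V) (x y : G.QutAlgebra) :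
    G.adjMatrix d (MinTensor G.QutAlgebra G.QutAlgebra) i j * MinTensor.tmul x y =
      MinTensor.tmul (G.adjMatrix d G.QutAlgebra i j * x) y := by
  unfold adjMatrix
  split_ifs
  · rw [one_mul, one_mul]
  · rw [zero_mul, zero_mul, MinTensor.zero_tmul]

lemma adjMatrix_tmul' (d : D) (i j : V) (x y : G.QutAlgebra) :
    MinTensor.tmul (x * G.adjMatrix d G.QutAlgebra i j) y =
      MinTensor.tmul x (G.adjMatrix d G.QutAlgebra i j * y) := by
  unfold adjMatrix
  split_ifs
  · rw [one_mul, mul_one]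
  · rw [zero_mul, mul_zero, MinTensor.zero_tmul, MinTensor.tmul_zero]

/-- The coproduct `Δ_G : C(Qut(G)) → C(Qut(G)) ⊗ C(Qut(G))`, `u_{ac} ↦ ∑_b u_{ab} ⊗ u_{bc}`. -/
def comul : G.QutAlgebra →⋆ₐ[ℂ] MinTensor G.QutAlgebra G.QutAlgebra :=
  UniversalCStarAlgebra.lift _ (fun x : V × V => G.comulEntry x.1 x.2) fun a b h => by
    classical
    have hA : ∀ d i j, FreeStarAlgebra.lift (fun x : V × V => G.comulEntry x.1 x.2)
        (G.adjMatrix d (FreeStarAlgebra (V × V)) i j) =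
          G.adjMatrix d (MinTensor G.QutAlgebra G.QutAlgebra) i j := fun d i j =>
      G.map_adjMatrix (FreeStarAlgebra.lift (fun x : V × V => G.comulEntry x.1 x.2)) d i j
    cases h with
    | selfAdjoint i j =>
      simp only [map_star, FreeStarAlgebra.lift_gen, comulEntry, star_sum, MinTensor.star_tmul,
        star_u]
    | sq i j =>
      simp only [map_mul, FreeStarAlgebra.lift_gen, comulEntry, sq, Finset.sum_mul_sum,
        MinTensor.tmul_mul, u_mul_u_row]
      refine Finset.sum_congr rfl fun k _ => ?_
      rw [Finset.sum_eq_single k]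
      · rw [if_pos rfl, u_mul_self]
      · intro l _ hl
        rw [if_neg hl.symm, MinTensor.zero_tmul]
      · simp
    | row i =>
      simp only [map_sum, FreeStarAlgebra.lift_gen, comulEntry, map_one]
      rw [Finset.sum_comm]
      simp only [← MinTensor.tmul_sum, sum_row]
      rw [← MinTensor.sum_tmul, sum_row, MinTensor.one_tmul_one]
    | col i =>
      simp only [map_sum, FreeStarAlgebra.lift_gen, comulEntry, map_one]
      rw [Finset.sum_comm]
      simp only [← MinTensor.sum_tmul, sum_col]
      rw [← MinTensor.tmul_sum, sum_col, MinTensor.one_tmul_one]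
    | color i j h =>
      rw [FreeStarAlgebra.lift_gen, map_zero]
      refine Finset.sum_eq_zero fun k _ => ?_
      by_cases hk : G.vertexColor i = G.vertexColor k
      · rw [G.u_color k j (fun h' => h (hk.trans h')), MinTensor.tmul_zero]
      · rw [G.u_color i k hk, MinTensor.zero_tmul]
    | adj d i j =>
      simp only [map_sum, map_mul, FreeStarAlgebra.lift_gen, hA]
      simp only [comulEntry, Finset.sum_mul, Finset.mul_sum, tmul_adjMatrix, adjMatrix_tmul]
      rw [Finset.sum_comm]
      simp only [← MinTensor.tmul_sum, u_adj]
      simp only [MinTensor.tmul_sum, ← adjMatrix_tmul']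
      rw [Finset.sum_comm]
      simp only [← MinTensor.sum_tmul, u_adj]
      simp only [MinTensor.sum_tmul]
      exact Finset.sum_comm

lemma comul_u (a c : V) : G.comul (G.u a c) = ∑ b, MinTensor.tmul (G.u a b) (G.u b c) :=
  UniversalCStarAlgebra.lift_gen _ _ _ (a, c)

end ColoredGraph

/-! ### Solution groups and the graph of a linear system over `𝔽₂` -/

/-- The support `S_k(M)` of the `k`-th equation, as a type. -/
abbrev equationSupport {m n : ℕ} (M : Matrix (Fin m) (Fin n) (ZMod 2)) (k : Fin m) : Type :=
  {i : Fin n // M k i = 1}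

/-- The relators of the homogeneous solution group. The product in the third family is taken in
increasing order of the index; by the second family the order is irrelevant. -/
inductive SolutionRelator {m n : ℕ} (M : Matrix (Fin m) (Fin n) (ZMod 2)) :
    FreeGroup (Fin n) → Prop
  | sq (i : Fin n) : SolutionRelator M (FreeGroup.of i ^ 2)
  | comm (i j : Fin n) (k : Fin m) (hi : M k i = 1) (hj : M k j = 1) :
      SolutionRelator M (FreeGroup.of i * FreeGroup.of j * (FreeGroup.of j * FreeGroup.of i)⁻¹)
  | eqn (k : Fin m) :
      SolutionRelator M
        ((((List.finRange n).filter fun i => M k i = 1).map FreeGroup.of).prod)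

/-- The homogeneous solution group `Γ₀(M)` of the linear system `M x = 0`. -/
abbrev HomogeneousSolutionGroup {m n : ℕ} (M : Matrix (Fin m) (Fin n) (ZMod 2)) : Type :=
  PresentedGroup {r | SolutionRelator M r}

/-- The vertices of `G(M, b)`: pairs `(k, α)` of an equation and a solution
`α : S_k → {1, -1}` of it in multiplicative form, `∏ αᵢ = (-1)^{b_k}`. -/
abbrev SystemVertex {m n : ℕ} (M : Matrix (Fin m) (Fin n) (ZMod 2)) (b : Fin m → ZMod 2) :
    Type :=
  Σ k : Fin m, {α : equationSupport M k → ℤˣ // ∏ i, α i = (-1) ^ (b k).val}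

instance {m n : ℕ} (M : Matrix (Fin m) (Fin n) (ZMod 2)) (b : Fin m → ZMod 2) :
    Fintype (SystemVertex M b) :=
  have (k : Fin m) : Fintype {α : equationSupport M k → ℤˣ // ∏ i, α i = (-1) ^ (b k).val} :=
    inferInstance
  inferInstance

/-- The function `α △ β : S_l ∩ S_k → {1, -1}`, `i ↦ αᵢ βᵢ`, as a partial function on `Fin n`
whose domain (the set of indices with a value other than `none`) is `S_l ∩ S_k`. -/
def symmDiffColor {m n : ℕ} {M : Matrix (Fin m) (Fin n) (ZMod 2)} {b : Fin m → ZMod 2}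
    (v w : SystemVertex M b) : Fin n → Option ℤˣ := fun i =>
  if h : M v.1 i = 1 ∧ M w.1 i = 1 then some (v.2.1 ⟨i, h.1⟩ * w.2.1 ⟨i, h.2⟩) else none

lemma symmDiffColor_comm {m n : ℕ} {M : Matrix (Fin m) (Fin n) (ZMod 2)} {b : Fin m → ZMod 2}
    (v w : SystemVertex M b) : symmDiffColor v w = symmDiffColor w v := by
  funext i
  unfold symmDiffColor
  by_cases h : M v.1 i = 1 ∧ M w.1 i = 1
  · rw [dif_pos h, dif_pos h.symm, mul_comm]
  · rw [dif_neg h, dif_neg (fun h' => h h'.symm)]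

/-- The colored graph `G(M, b)`: distinct vertices `(l, α)` and `(k, β)` are adjacent if and only
if `S_l ∩ S_k` is nonempty, `(k, α)` has color `k`, and the edge between `(l, α)` and `(k, β)` has
color `α △ β`. -/
def systemGraph {m n : ℕ} (M : Matrix (Fin m) (Fin n) (ZMod 2)) (b : Fin m → ZMod 2) :
    ColoredGraph (SystemVertex M b) (Fin m) (Fin n → Option ℤˣ) where
  graph :=
    { Adj := fun v w => v ≠ w ∧ ∃ i, M v.1 i = 1 ∧ M w.1 i = 1
      symm := ⟨fun _ _ h => ⟨h.1.symm, h.2.imp fun _ hi => hi.symm⟩⟩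
      loopless := ⟨fun _ h => h.1 rfl⟩ }
  vertexColor v := v.1
  edgeColor e := Sym2.lift ⟨symmDiffColor, symmDiffColor_comm⟩ e.1

end

/-!
Both algebras are universal for the same data, namely *operator solutions* of the homogeneous
system (`IsOperatorSolution`): self-adjoint unitaries `xᵢ` such that the variables of each equation
commute and multiply to `1`. For `C*(Γ₀(M))` this is the presentation of the group.

Given an operator solution, the commuting variables of the equation `k` have joint spectral
projections, and the projection of an odd sign pattern vanishes because the product of the variables
is `1`. Let `P_{vw}`, for vertices `v = (k, α)` and `w = (k, β)`, be the projection of the pattern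
`α β`, and let `P_{vw} = 0` if the vertex colors differ. This matrix satisfies the relations of
`C(Qut(G))`: it is a magic unitary because `β ↦ α β` is a bijection onto the even patterns, and it
commutes with the adjacency matrices because `P_{vk} P_{jw} ≠ 0` forces the signs of `v, k` and
of `j, w` to change in the same way at every common variable, so that the edges `vj` and `kw` have
the same color (`IsSpectralMatrix.comm_adjMatrix`).

Conversely, in `C(Qut(G))` put `xᵢ = ∑_w αᵢ βᵢ u_{vw}`, where `v = (k, α)` with `i ∈ S_k` is fixed
and `w = (k, β)` varies. The entries of a row are orthogonal projections with sum `1`, which gives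
the relations within one equation. That `xᵢ` does not depend on `v` (`rowVar_eq_rowVar`) follows by
adding up the relations `A_{G_d} u = u A_{G_d}` over all colors `d`, weighted by the value of `d` at
`i`: the weighted sum of adjacency matrices has the entries `αᵢ βᵢ` off the diagonal, so that the
relation equates the row sum at `v` with a column sum at `w`, for arbitrary `v` and `w` whose
equations contain `i`.

The two constructions are mutually inverse since a matrix of joint eigenprojections is determined by
the `xᵢ` (`IsSpectralMatrix.unique`). The coproducts agree because `Δ_G(xᵢ) = xᵢ ⊗ xᵢ`
(`comul_eq_tmul`).
-/

noncomputable section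

universe u v w

/-! ### Homomorphisms out of universal C*-algebras -/

/-- Two `*`-homomorphisms out of a universal C*-algebra agree if they agree on the generators. -/
lemma UniversalCStarAlgebra.hom_ext {X : Type u}
    {R : FreeStarAlgebra X → FreeStarAlgebra X → Prop} [BoundedRelations R]
    {B : Type v} [CStarAlgebra B] {f g : UniversalCStarAlgebra R →⋆ₐ[ℂ] B}
    (h : ∀ x, f (gen R x) = g (gen R x)) : f = g := by
  have hf : Continuous f := AddMonoidHomClass.continuous_of_bound f 1 fun a => by
    simpa using NonUnitalStarAlgHom.norm_apply_le f a
  have hg : Continuous g := AddMonoidHomClass.continuous_of_bound g 1 fun a => by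
    simpa using NonUnitalStarAlgHom.norm_apply_le g a
  refine StarAlgHom.ext fun x => ?_
  refine (universalSeminorm R).denseRange_of.induction_on (p := fun x => f x = g x) x
    (isClosed_eq hf hg) fun a => ?_
  change f (mk R a) = g (mk R a)
  induction a using FreeStarAlgebra.induction with
  | scalar c => simp only [AlgHomClass.commutes]
  | let_ y =>
    rcases y with ⟨x, _ | _⟩
    · have hx : FreeStarAlgebra.letter (x, false) = star (FreeStarAlgebra.gen x) :=
        (FreeStarAlgebra.star_letter (x, true)).symm
      rw [hx, map_star, map_star, map_star]
      exact congrArg star (h x)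
    · exact h x
  | add a b ha hb => simp only [map_add, ha, hb]
  | mul a b ha hb => simp only [map_mul, ha, hb]

lemma GroupCStarAlgebra.u_one {Γ : Type u} [Group Γ] : (u (1 : Γ)) = 1 := by
  have h := u_mul (1 : Γ) 1
  rw [mul_one] at h
  have h' := congrArg (star (u (1 : Γ)) * ·) h
  simpa only [← mul_assoc, star_u_mul_u, one_mul] using h'.symm

/-! ### Operator solutions of the homogeneous system -/

/-- An operator solution of the homogeneous system `M x = 0`: self-adjoint unitaries `xᵢ` such
that the variables of each equation commute and multiply to `1`. As in the presentation of the
solution group, the product is taken in increasing order of the index. -/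
structure IsOperatorSolution {m n : ℕ} (M : Matrix (Fin m) (Fin n) (ZMod 2))
    {B : Type v} [Ring B] [StarRing B] (x : Fin n → B) : Prop where
  star_eq : ∀ i, star (x i) = x i
  mul_self : ∀ i, x i * x i = 1
  commute : ∀ k i j, M k i = 1 → M k j = 1 → x i * x j = x j * x i
  prod_eq_one : ∀ k, (((List.finRange n).filter fun i => M k i = 1).map x).prod = 1

/-- The canonical generators of `C*(Γ₀(M))`. -/
def solutionGen {m n : ℕ} (M : Matrix (Fin m) (Fin n) (ZMod 2)) (i : Fin n) :
    GroupCStarAlgebra (HomogeneousSolutionGroup M) :=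
  GroupCStarAlgebra.u (PresentedGroup.of i)

section SolutionGroup

variable {m n : ℕ} {M : Matrix (Fin m) (Fin n) (ZMod 2)}

lemma isOperatorSolution_solutionGen (M : Matrix (Fin m) (Fin n) (ZMod 2)) :
    IsOperatorSolution M (solutionGen M) := by
  have hsq : ∀ i, (PresentedGroup.of i : HomogeneousSolutionGroup M) * PresentedGroup.of i = 1 :=
    fun i => by
      have h := PresentedGroup.one_of_mem (rels := {r | SolutionRelator M r})
        (SolutionRelator.sq i)
      rwa [sq, map_mul] at h
  have hmul : ∀ i, solutionGen M i * solutionGen M i = 1 := fun i => by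
    rw [solutionGen, ← GroupCStarAlgebra.u_mul, hsq, GroupCStarAlgebra.u_one]
  refine ⟨fun i => ?_, hmul, fun k i j hi hj => ?_, fun k => ?_⟩
  · rw [solutionGen, ← GroupCStarAlgebra.u_inv, inv_eq_of_mul_eq_one_left (hsq i)]
  · have h := PresentedGroup.one_of_mem (rels := {r | SolutionRelator M r})
      (SolutionRelator.comm i j k hi hj)
    rw [map_mul, map_inv, mul_inv_eq_one, map_mul, map_mul] at h
    simp only [solutionGen, ← GroupCStarAlgebra.u_mul]
    exact congrArg _ h
  · have h := PresentedGroup.one_of_mem (rels := {r | SolutionRelator M r})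
      (SolutionRelator.eqn k)
    -- `u` as a monoid homomorphism, to be applied to the product of the relator
    let U : HomogeneousSolutionGroup M →* GroupCStarAlgebra (HomogeneousSolutionGroup M) :=
      { toFun := GroupCStarAlgebra.u
        map_one' := GroupCStarAlgebra.u_one
        map_mul' := GroupCStarAlgebra.u_mul }
    have h2 := congrArg U h
    rw [map_one, map_list_prod, map_list_prod, List.map_map, List.map_map] at h2
    exact h2

variable {B : Type v} [CStarAlgebra B]

/-- Two `*`-homomorphisms out of `C*(Γ₀(M))` agree if they agree on the `xᵢ`. -/
lemma solutionGroup_hom_ext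
    {f g : GroupCStarAlgebra (HomogeneousSolutionGroup M) →⋆ₐ[ℂ] B}
    (h : ∀ i, f (solutionGen M i) = g (solutionGen M i)) : f = g := by
  refine UniversalCStarAlgebra.hom_ext fun a => ?_
  change f (GroupCStarAlgebra.u a) = g (GroupCStarAlgebra.u a)
  have ha : a ∈ Subgroup.closure
      (Set.range (PresentedGroup.of : Fin n → HomogeneousSolutionGroup M)) := by
    rw [PresentedGroup.closure_range_of]; trivial
  induction ha using Subgroup.closure_induction with
  | mem _ hx => obtain ⟨i, rfl⟩ := hx; exact h i
  | one => rw [GroupCStarAlgebra.u_one, map_one, map_one]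
  | mul a b _ _ ha hb => rw [GroupCStarAlgebra.u_mul, map_mul, map_mul, ha, hb]
  | inv a _ ha => rw [GroupCStarAlgebra.u_inv, map_star, map_star, ha]

/-- An operator solution, as a family of unitaries. -/
def IsOperatorSolution.toUnitary {x : Fin n → B} (hx : IsOperatorSolution M x) (i : Fin n) :
    unitary B :=
  ⟨x i, by rw [Unitary.mem_iff, hx.star_eq, hx.mul_self]; exact ⟨rfl, rfl⟩⟩

/-- The unitary representation of `Γ₀(M)` given by an operator solution. -/
def IsOperatorSolution.groupHom {x : Fin n → B} (hx : IsOperatorSolution M x) :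
    HomogeneousSolutionGroup M →* unitary B :=
  PresentedGroup.toGroup (f := hx.toUnitary) fun r hr => by
    cases hr with
    | sq i =>
      rw [map_pow, FreeGroup.lift_apply_of, sq]
      exact Subtype.ext (hx.mul_self i)
    | comm i j k hi hj =>
      rw [map_mul, map_inv, map_mul, map_mul, FreeGroup.lift_apply_of, FreeGroup.lift_apply_of,
        mul_inv_eq_one]
      exact Subtype.ext (hx.commute k i j hi hj)
    | eqn k =>
      refine Subtype.ext ?_
      rw [map_list_prod, List.map_map]
      change (Submonoid.subtype (unitary B)) _ = _
      rw [map_list_prod, List.map_map]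
      refine Eq.trans (congrArg List.prod (List.map_congr_left fun i _ => ?_)) (hx.prod_eq_one k)
      simp [IsOperatorSolution.toUnitary]

/-- The `*`-homomorphism out of `C*(Γ₀(M))` given by an operator solution. -/
def IsOperatorSolution.lift {x : Fin n → B} (hx : IsOperatorSolution M x) :
    GroupCStarAlgebra (HomogeneousSolutionGroup M) →⋆ₐ[ℂ] B :=
  UniversalCStarAlgebra.lift _ (fun g => (hx.groupHom g : B)) fun a b h => by
    cases h with
    | star_mul_self g =>
      rw [map_mul, map_star, map_one, FreeStarAlgebra.lift_gen, Unitary.coe_star_mul_self]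
    | mul_star_self g =>
      rw [map_mul, map_star, map_one, FreeStarAlgebra.lift_gen,
        Unitary.mul_star_self_of_mem (hx.groupHom g).2]
    | mul g h => simp only [map_mul, FreeStarAlgebra.lift_gen, Submonoid.coe_mul]
    | inv g =>
      rw [map_star, FreeStarAlgebra.lift_gen, FreeStarAlgebra.lift_gen, map_inv,
        ← Unitary.star_eq_inv, Unitary.coe_star]

lemma IsOperatorSolution.lift_solutionGen {x : Fin n → B} (hx : IsOperatorSolution M x)
    (i : Fin n) : hx.lift (solutionGen M i) = x i := by
  refine (UniversalCStarAlgebra.lift_gen _ _ _ _).trans ?_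
  rw [IsOperatorSolution.groupHom, PresentedGroup.toGroup.of]
  rfl

end SolutionGroup

/-! ### Joint spectral projections of commuting symmetries -/

/-- Commuting self-adjoint unitaries `y i` in a commutative algebra: the joint spectral projection
for the eigenvalues `α i` is `∏ i, (1 + α i • y i) / 2`. -/
lemma exists_jointSpectralProjections_of_comm {ι : Type*} [Fintype ι] [DecidableEq ι]
    {A : Type*} [CommRing A] [StarRing A] [Algebra ℂ A] [StarModule ℂ A] (y : ι → A)
    (hstar : ∀ i, star (y i) = y i)
    (hsq : ∀ i, y i * y i = 1) :
    ∃ q : (ι → ℤˣ) → A, (∀ α, star (q α) = q α) ∧ (∀ α, q α * q α = q α) ∧ ∑ α, q α = 1 ∧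
      ∀ i α, y i * q α = α i • q α := by
  let e : ℤˣ → ι → A := fun s i => (1 / 2 : ℂ) • (1 + s • y i)
  have hs : ∀ s i, star (e s i) = e s i := fun s i => by
    simp [e, Units.smul_def, hstar]
  have hmul : ∀ s i, y i * e s i = s • e s i := fun s i => by
    simp only [e]
    rw [mul_smul_comm, mul_add, mul_one, mul_smul_comm, hsq, smul_comm s, smul_add s, smul_smul,
      Int.units_mul_self, one_smul, add_comm]
  have hhalf : ∀ a : A, (1 / 2 : ℂ) • (a + a) = a := fun a => by
    rw [← two_smul ℂ a, smul_smul]; norm_num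
  refine ⟨fun α => ∏ i, e (α i) i, fun α => ?_, fun α => ?_, ?_, fun i α => ?_⟩
  · simp only [star_prod, hs]
  · rw [← Finset.prod_mul_distrib]
    refine Finset.prod_congr rfl fun i _ => ?_
    generalize α i = s
    have h1 : e s i * e s i = (1 / 2 : ℂ) • (e s i + s • (y i * e s i)) := by
      conv_lhs => enter [1]; simp only [e]
      rw [smul_mul_assoc, add_mul, one_mul, smul_mul_assoc]
    rw [h1, hmul, smul_smul, Int.units_mul_self, one_smul, hhalf]
  · refine (Fintype.prod_sum fun i s => e s i).symm.trans ?_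
    refine Finset.prod_eq_one fun i _ => ?_
    rw [UnitsInt.univ, Finset.sum_pair (by decide), ← smul_add]
    have : (1 + (1 : ℤˣ) • y i + (1 + (-1 : ℤˣ) • y i)) = 1 + 1 := by
      rw [one_smul, Units.neg_smul, one_smul]; abel
    rw [this, hhalf]
  · simp only
    rw [← Finset.mul_prod_erase _ _ (Finset.mem_univ i), ← mul_assoc, hmul, smul_mul_assoc]

open scoped IsMulCommutative in
/-- Pairwise commuting self-adjoint unitaries have joint spectral projections. -/
lemma exists_jointSpectralProjections {ι : Type*} [Fintype ι] [DecidableEq ι] {B : Type*} [Ring B]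
    [StarRing B] [Algebra ℂ B] [StarModule ℂ B] (y : ι → B) (hstar : ∀ i, star (y i) = y i)
    (hsq : ∀ i, y i * y i = 1) (hcomm : ∀ i j, y i * y j = y j * y i) :
    ∃ q : (ι → ℤˣ) → B, (∀ α, star (q α) = q α) ∧ (∀ α, q α * q α = q α) ∧ ∑ α, q α = 1 ∧
      ∀ i α, y i * q α = α i • q α := by
  have hmem : ∀ i, y i ∈ StarAlgebra.adjoin ℂ (Set.range y) := fun i =>
    StarAlgebra.subset_adjoin ℂ _ (Set.mem_range_self i)
  have _ : IsMulCommutative (StarAlgebra.adjoin ℂ (Set.range y)) :=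
    StarAlgebra.isMulCommutative_adjoin ℂ
      (by rintro _ ⟨i, rfl⟩ _ ⟨j, rfl⟩; exact hcomm i j)
      (by rintro _ ⟨i, rfl⟩ _ ⟨j, rfl⟩; rw [hstar]; exact hcomm i j)
  obtain ⟨q, h1, h2, h3, h4⟩ := exists_jointSpectralProjections_of_comm
    (A := StarAlgebra.adjoin ℂ (Set.range y)) (fun i => ⟨y i, hmem i⟩)
    (fun i => Subtype.ext (hstar i)) (fun i => Subtype.ext (hsq i))
  refine ⟨fun α => q α, fun α => congrArg Subtype.val (h1 α), fun α => congrArg Subtype.val (h2 α),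
    ?_, fun i α => ?_⟩
  · have h := congrArg (StarAlgebra.adjoin ℂ (Set.range y)).subtype h3
    rwa [map_sum, map_one] at h
  · have h := congrArg (StarAlgebra.adjoin ℂ (Set.range y)).subtype (h4 i α)
    rwa [map_mul, Units.smul_def, map_zsmul] at h

/-! ### Signs of vertices and magic unitaries with prescribed eigenvalues -/

section Graph

variable {m n : ℕ} {M : Matrix (Fin m) (Fin n) (ZMod 2)} {b : Fin m → ZMod 2}

/-- The value `αᵢ` at `i` of the vertex `(k, α)`, extended by `1` to all `i ∉ S_k`. -/
def SystemVertex.sign (v : SystemVertex M b) (i : Fin n) : ℤˣ :=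
  if h : M v.1 i = 1 then v.2.1 ⟨i, h⟩ else 1

lemma SystemVertex.sign_of_mem (v : SystemVertex M b) {i : Fin n} (h : M v.1 i = 1) :
    v.sign i = v.2.1 ⟨i, h⟩ := dif_pos h

lemma SystemVertex.ext_sign {v w : SystemVertex M b} (hc : v.1 = w.1)
    (h : ∀ i, M v.1 i = 1 → v.sign i = w.sign i) : v = w := by
  obtain ⟨k, α, hα⟩ := v
  obtain ⟨l, β, hβ⟩ := w
  obtain rfl : k = l := hc
  congr 2
  funext ⟨i, hi⟩
  have := h i hi
  rwa [sign_of_mem _ hi, sign_of_mem _ hi] at this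

lemma prod_map_filter_finRange {G : Type*} [CommMonoid G] (M : Matrix (Fin m) (Fin n) (ZMod 2))
    (k : Fin m) (f : Fin n → G) :
    (((List.finRange n).filter fun i => M k i = 1).map f).prod =
      ∏ i : equationSupport M k, f i := by
  rw [← List.prod_toFinset _ ((List.nodup_finRange n).filter _)]
  exact Finset.prod_subtype _ (by simp) _

lemma SystemVertex.prod_sign (v : SystemVertex M b) :
    ∏ i : equationSupport M v.1, v.sign i = (-1) ^ (b v.1).val := by
  rw [← v.2.2]
  exact Finset.prod_congr rfl fun i _ => v.sign_of_mem i.2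

lemma exists_vertex_of_mem {k : Fin m} {i : Fin n} (hi : M k i = 1) :
    ∃ v : SystemVertex M b, v.1 = k := by
  refine ⟨⟨k, Pi.mulSingle ⟨i, hi⟩ ((-1) ^ (b k).val), ?_⟩, rfl⟩
  simp

/-- Two edges of `G(M, b)` have the same color if and only if their end points have the same
common variables, with the same products of signs. -/
lemma symmDiffColor_eq_iff {v w v' w' : SystemVertex M b} (hv : v.1 = v'.1) (hw : w.1 = w'.1) :
    symmDiffColor v w = symmDiffColor v' w' ↔
      ∀ i, M v.1 i = 1 → M w.1 i = 1 → v.sign i * w.sign i = v'.sign i * w'.sign i := by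
  have key : ∀ (v w : SystemVertex M b) i, symmDiffColor v w i =
      if M v.1 i = 1 ∧ M w.1 i = 1 then some (v.sign i * w.sign i) else none := fun v w i => by
    unfold symmDiffColor
    split_ifs with h
    · rw [v.sign_of_mem h.1, w.sign_of_mem h.2]
    · rfl
  rw [funext_iff]
  refine forall_congr' fun i => ?_
  rw [key, key, ← hv, ← hw]
  split_ifs with h
  · rw [Option.some_inj]; tauto
  · tauto

lemma symmDiffColor_of_mem {v w : SystemVertex M b} {i : Fin n} (hv : M v.1 i = 1)
    (hw : M w.1 i = 1) : symmDiffColor v w i = some (v.sign i * w.sign i) := by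
  rw [symmDiffColor, dif_pos ⟨hv, hw⟩, v.sign_of_mem hv, w.sign_of_mem hw]

lemma adjMatrix_systemGraph (d : Fin n → Option ℤˣ) (R : Type*) [Zero R] [One R]
    (v w : SystemVertex M b) [Decidable ((v ≠ w ∧ ∃ i, M v.1 i = 1 ∧ M w.1 i = 1) ∧
      symmDiffColor v w = d)] :
    (systemGraph M b).adjMatrix d R v w =
      if (v ≠ w ∧ ∃ i, M v.1 i = 1 ∧ M w.1 i = 1) ∧ symmDiffColor v w = d then 1 else 0 := by
  unfold ColoredGraph.adjMatrix
  congr 1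
  exact propext ⟨fun ⟨h, h'⟩ => ⟨h, h'⟩, fun ⟨h, h'⟩ => ⟨h, h'⟩⟩

/-- A magic unitary indexed by the vertices of `G(M, b)`, block diagonal with respect to the vertex
colors, each row of which consists of joint eigenprojections of the variables `xᵢ` of an
equation: on the range of `P_{vw}`, `xᵢ` acts by the sign `αᵢ βᵢ`. -/
structure IsSpectralMatrix {B : Type v} [Ring B] [StarRing B] (x : Fin n → B)
    (P : SystemVertex M b → SystemVertex M b → B) : Prop where
  star_eq : ∀ v w, star (P v w) = P v w
  mul_self : ∀ v w, P v w * P v w = P v w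
  row : ∀ v, ∑ w, P v w = 1
  col : ∀ v, ∑ w, P w v = 1
  color : ∀ v w, v.1 ≠ w.1 → P v w = 0
  eigen : ∀ v w i, M v.1 i = 1 → x i * P v w = (v.sign i * w.sign i) • P v w

namespace IsSpectralMatrix

variable {B : Type v} [Ring B] [StarRing B] [Algebra ℂ B] {x : Fin n → B}
  {P Q : SystemVertex M b → SystemVertex M b → B}

/-- Eigenprojections for different eigenvalues are orthogonal. -/
lemma mul_eq_zero (hx : IsOperatorSolution M x) (hP : IsSpectralMatrix x P)
    (hQ : IsSpectralMatrix x Q) {v k j w : SystemVertex M b} {i : Fin n} (hv : M v.1 i = 1)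
    (hj : M j.1 i = 1) (hne : v.sign i * k.sign i ≠ j.sign i * w.sign i) :
    P v k * Q j w = 0 := by
  have h1 : P v k * x i = (v.sign i * k.sign i) • P v k := by
    have h := congrArg star (hP.eigen v k i hv)
    rwa [star_mul, hx.star_eq, hP.star_eq, Units.smul_def, star_zsmul, hP.star_eq,
      ← Units.smul_def] at h
  have h2 : (v.sign i * k.sign i) • (P v k * Q j w) =
      (j.sign i * w.sign i) • (P v k * Q j w) := by
    rw [← smul_mul_assoc, ← h1, mul_assoc, hQ.eigen j w i hj, mul_smul_comm]
  have h3 : (j.sign i * w.sign i) = -(v.sign i * k.sign i) :=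
    ((Int.units_ne_iff_eq_neg).mp hne.symm)
  rw [h3, Units.neg_smul, eq_neg_iff_add_eq_zero, ← two_smul ℂ] at h2
  exact (smul_eq_zero_iff_eq _).mp ((smul_eq_zero.mp h2).resolve_left two_ne_zero)

/-- The eigenvalues determine a spectral matrix. -/
lemma unique (hx : IsOperatorSolution M x) (hP : IsSpectralMatrix x P)
    (hQ : IsSpectralMatrix x Q) (v w : SystemVertex M b) : P v w = Q v w := by
  have hzero : ∀ k l, k ≠ l → P v k * Q v l = 0 := fun k l hkl => by
    by_cases hk : v.1 = k.1
    · by_cases hl : v.1 = l.1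
      · obtain ⟨i, hi, hne⟩ : ∃ i, M k.1 i = 1 ∧ k.sign i ≠ l.sign i := by
          by_contra! h
          exact hkl (SystemVertex.ext_sign (hk.symm.trans hl) h)
        exact mul_eq_zero hx hP hQ (hk ▸ hi) (hk ▸ hi) fun h => hne (mul_left_cancel h)
      · rw [hQ.color v l hl, mul_zero]
    · rw [hP.color v k hk, zero_mul]
  have h1 : P v w = P v w * Q v w := by
    conv_lhs => rw [← mul_one (P v w), ← hQ.row v, Finset.mul_sum]
    exact Finset.sum_eq_single w (fun l _ hl => hzero w l hl.symm) (by simp)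
  have h2 : Q v w = P v w * Q v w := by
    conv_lhs => rw [← one_mul (Q v w), ← hP.row v, Finset.sum_mul]
    exact Finset.sum_eq_single w (fun l _ hl => hzero l w hl) (by simp)
  rw [h1, ← h2]

/-- A spectral matrix commutes with the adjacency matrices: if `P_{vk} P_{jw}` is nonzero, the
pairs `(v, j)` and `(k, w)` are related in the same way. -/
lemma comm_adjMatrix (hx : IsOperatorSolution M x) (hP : IsSpectralMatrix x P)
    (d : Fin n → Option ℤˣ) (v w : SystemVertex M b) :
    ∑ k, P v k * (systemGraph M b).adjMatrix d B k w =
      ∑ k, (systemGraph M b).adjMatrix d B v k * P k w := by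
  classical
  have key : ∀ k j, P v k * (systemGraph M b).adjMatrix d B k w * P j w =
      P v k * ((systemGraph M b).adjMatrix d B v j * P j w) := fun k j => by
    rw [← mul_assoc]
    by_cases hk : v.1 = k.1
    swap
    · simp only [hP.color v k hk, zero_mul]
    by_cases hj : j.1 = w.1
    swap
    · simp only [hP.color j w hj, mul_zero]
    by_cases h : ∀ i, M v.1 i = 1 → M j.1 i = 1 →
      v.sign i * k.sign i = j.sign i * w.sign i
    · have h' : ∀ i, M k.1 i = 1 → M w.1 i = 1 →
          k.sign i * w.sign i = v.sign i * j.sign i := fun i hki hwi => by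
        have := h i (hk ▸ hki) (hj ▸ hwi)
        have h1 := Int.units_mul_self (v.sign i)
        have h2 := Int.units_mul_self (w.sign i)
        calc k.sign i * w.sign i = v.sign i * v.sign i * (k.sign i * w.sign i) := by
              rw [h1, one_mul]
          _ = v.sign i * (v.sign i * k.sign i) * w.sign i := by simp only [mul_assoc]
          _ = v.sign i * j.sign i * (w.sign i * w.sign i) := by rw [this]; simp only [mul_assoc]
          _ = _ := by rw [h2, mul_one]
      have hcol : symmDiffColor k w = symmDiffColor v j :=
        (symmDiffColor_eq_iff hk.symm hj.symm).mpr h'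
      have heq : k = w ↔ v = j := by
        constructor
        · rintro rfl
          refine SystemVertex.ext_sign (hk.trans hj.symm) fun i hi => ?_
          have := h' i (hk ▸ hi) (hk ▸ hi)
          rw [Int.units_mul_self] at this
          exact (mul_eq_one_iff_eq_inv.mp this.symm).trans (Int.units_inv_eq_self _)
        · rintro rfl
          refine SystemVertex.ext_sign (hk.symm.trans hj) fun i hi => ?_
          have := h' i hi (hj ▸ hk ▸ hi)
          rw [Int.units_mul_self] at this
          exact (mul_eq_one_iff_eq_inv.mp this).trans (Int.units_inv_eq_self _)
      have hA : (systemGraph M b).adjMatrix d B k w = (systemGraph M b).adjMatrix d B v j := by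
        rw [adjMatrix_systemGraph, adjMatrix_systemGraph]
        simp only [hcol, ne_eq, heq, hk, hj]
      rw [hA]
    · push Not at h
      obtain ⟨i, hvi, hji, hne⟩ := h
      have h0 : P v k * P j w = 0 := mul_eq_zero hx hP hP hvi hji hne
      simp only [adjMatrix_systemGraph]
      split_ifs <;> simp [h0]
  -- insert column sums `∑ j, P j w = 1` on the left and row sums `∑ k, P v k = 1` on the right
  calc ∑ k, P v k * (systemGraph M b).adjMatrix d B k w
      = ∑ k, ∑ j, P v k * (systemGraph M b).adjMatrix d B k w * P j w := by
        simp only [← Finset.mul_sum, hP.col, mul_one]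
    _ = ∑ k, ∑ j, P v k * ((systemGraph M b).adjMatrix d B v j * P j w) := by simp only [key]
    _ = _ := by
        rw [Finset.sum_comm]
        simp only [← Finset.sum_mul, hP.row, one_mul]

end IsSpectralMatrix

/-- The `*`-homomorphism out of `C(Qut(G(M, b)))` given by a spectral matrix. -/
def IsSpectralMatrix.lift {B : Type v} [CStarAlgebra B] {x : Fin n → B}
    {P : SystemVertex M b → SystemVertex M b → B} (hx : IsOperatorSolution M x)
    (hP : IsSpectralMatrix x P) : (systemGraph M b).QutAlgebra →⋆ₐ[ℂ] B :=
  UniversalCStarAlgebra.lift _ (fun e => P e.1 e.2) fun a c h => by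
    have hA : ∀ d i j, FreeStarAlgebra.lift
        (fun e : SystemVertex M b × SystemVertex M b => P e.1 e.2)
        ((systemGraph M b).adjMatrix d (FreeStarAlgebra _) i j) =
          (systemGraph M b).adjMatrix d B i j := fun d i j =>
      (systemGraph M b).map_adjMatrix (FreeStarAlgebra.lift _) d i j
    cases h with
    | selfAdjoint i j => rw [map_star, FreeStarAlgebra.lift_gen, hP.star_eq]
    | sq i j => rw [map_pow, FreeStarAlgebra.lift_gen, sq, hP.mul_self]
    | row i => simp only [map_sum, FreeStarAlgebra.lift_gen, map_one, hP.row]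
    | col i => simp only [map_sum, FreeStarAlgebra.lift_gen, map_one, hP.col]
    | color i j h => rw [FreeStarAlgebra.lift_gen, map_zero, hP.color _ _ h]
    | adj d i j =>
      simp only [map_sum, map_mul, FreeStarAlgebra.lift_gen, hA]
      exact hP.comm_adjMatrix hx d i j

lemma IsSpectralMatrix.lift_u {B : Type v} [CStarAlgebra B] {x : Fin n → B}
    {P : SystemVertex M b → SystemVertex M b → B} (hx : IsOperatorSolution M x)
    (hP : IsSpectralMatrix x P) (v w : SystemVertex M b) :
    IsSpectralMatrix.lift hx hP ((systemGraph M b).u v w) = P v w :=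
  UniversalCStarAlgebra.lift_gen _ _ _ _

lemma IsSpectralMatrix.map {B : Type v} [Ring B] [StarRing B] [Algebra ℂ B]
    {C : Type w} [Ring C] [StarRing C] [Algebra ℂ C] {x : Fin n → B}
    {P : SystemVertex M b → SystemVertex M b → B} (hP : IsSpectralMatrix x P) (f : B →⋆ₐ[ℂ] C) :
    IsSpectralMatrix (fun i => f (x i)) fun v w => f (P v w) where
  star_eq v w := by rw [← map_star, hP.star_eq]
  mul_self v w := by rw [← map_mul, hP.mul_self]
  row v := by rw [← map_sum, hP.row, map_one]
  col v := by rw [← map_sum, hP.col, map_one]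
  color v w h := by rw [hP.color v w h, map_zero]
  eigen v w i hi := by
    rw [← map_mul, hP.eigen v w i hi, Units.smul_def, map_zsmul, Units.smul_def]

lemma sum_systemVertex {B : Type*} [AddCommMonoid B] (f : SystemVertex M b → B) :
    ∑ w, f w =
      ∑ k, ∑ α : {α : equationSupport M k → ℤˣ // ∏ i, α i = (-1) ^ (b k).val}, f ⟨k, α⟩ := by
  let _ (k : Fin m) : Fintype {α : equationSupport M k → ℤˣ // ∏ i, α i = (-1) ^ (b k).val} :=
    inferInstance
  exact Fintype.sum_sigma f

/-- Every operator solution has a spectral matrix. -/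
lemma IsOperatorSolution.exists_isSpectralMatrix {B : Type v} [Ring B] [StarRing B] [Algebra ℂ B]
    [StarModule ℂ B] {x : Fin n → B} (hx : IsOperatorSolution M x) (b : Fin m → ZMod 2) :
    ∃ P : SystemVertex M b → SystemVertex M b → B, IsSpectralMatrix x P := by
  choose q hstar hsq hsum heig using fun k => exists_jointSpectralProjections
    (fun i : equationSupport M k => x i) (fun i => hx.star_eq i) (fun i => hx.mul_self i)
    (fun i j => hx.commute k i j i.2 j.2)
  -- the product of the variables of an equation is `1`, so odd sign patterns do not occur
  have hodd : ∀ k (α : equationSupport M k → ℤˣ), ∏ i, α i ≠ 1 → q k α = 0 := fun k α hα => by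
    let α' : Fin n → ℤˣ := fun i => if h : M k i = 1 then α ⟨i, h⟩ else 1
    have hα' : ∀ i : equationSupport M k, α' i = α i := fun i => dif_pos i.2
    have hlist : ∀ L : List (Fin n), (∀ i ∈ L, M k i = 1) →
        (L.map x).prod * q k α = (L.map α').prod • q k α := fun L => by
      induction L with
      | nil => intro _; simp
      | cons i L ih =>
        intro hL
        have hi : M k i = 1 := hL i List.mem_cons_self
        rw [List.map_cons, List.map_cons, List.prod_cons, List.prod_cons, mul_assoc,
          ih fun j hj => hL j (List.mem_cons_of_mem _ hj), mul_smul_comm, heig k ⟨i, hi⟩ α,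
          ← hα', smul_smul, mul_comm]
    have h := hlist ((List.finRange n).filter fun i => M k i = 1) fun i hi => by
      simpa using (List.mem_filter.mp hi).2
    rw [hx.prod_eq_one, one_mul, prod_map_filter_finRange] at h
    simp only [hα'] at h
    rw [Int.units_ne_iff_eq_neg.mp hα, Units.neg_smul, one_smul, eq_neg_iff_add_eq_zero,
      ← two_smul ℂ] at h
    exact (smul_eq_zero.mp h).resolve_left two_ne_zero
  let P : SystemVertex M b → SystemVertex M b → B := fun v w =>
    if v.1 = w.1 then q v.1 fun i => v.sign i * w.sign i else 0
  have hsymm : ∀ v w, P v w = P w v := by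
    rintro ⟨k, α⟩ ⟨l, β⟩
    by_cases h : k = l
    · subst h
      simp only [P, if_true, mul_comm]
    · simp only [P, if_neg h, if_neg (Ne.symm h)]
  have hrow : ∀ v, ∑ w, P v w = 1 := fun v => by
    -- by `hodd`, the sum over the solutions of the equation is the sum over all sign patterns
    let f : (equationSupport M v.1 → ℤˣ) → B := fun α => q v.1 (v.2.1 * α)
    calc ∑ w, P v w = ∑ k, ∑ α : {α : equationSupport M k → ℤˣ // ∏ i, α i = (-1) ^ (b k).val},
          P v ⟨k, α⟩ := sum_systemVertex (P v)
      _ = ∑ α : {α : equationSupport M v.1 → ℤˣ // ∏ i, α i = (-1) ^ (b v.1).val},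
          P v ⟨v.1, α⟩ :=
        Finset.sum_eq_single v.1
          (fun k _ hk => Finset.sum_eq_zero fun α _ => if_neg hk.symm) (by simp)
      _ = ∑ α : {α : equationSupport M v.1 → ℤˣ // ∏ i, α i = (-1) ^ (b v.1).val}, f α := by
        refine Finset.sum_congr rfl fun α _ => (if_pos rfl).trans (congrArg _ ?_)
        funext i
        exact congrArg₂ (· * ·) (v.sign_of_mem i.2)
          (SystemVertex.sign_of_mem (⟨v.1, α⟩ : SystemVertex M b) i.2)
      _ = ∑ α with ∏ i, α i = (-1) ^ (b v.1).val, f α :=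
        (Finset.sum_subtype _ (by simp) _).symm
      _ = ∑ α, f α := by
        refine Finset.sum_filter_of_ne fun α _ hα => ?_
        by_contra hne
        refine hα (hodd _ _ fun h => hne ?_)
        simp only [Pi.mul_apply, Finset.prod_mul_distrib, v.2.2] at h
        rw [mul_eq_one_iff_eq_inv.mp h, Int.units_inv_eq_self]
      _ = ∑ α, q v.1 α := Equiv.sum_comp (Equiv.mulLeft v.2.1) (q v.1)
      _ = 1 := hsum v.1
  refine ⟨P, ?_, ?_, hrow, fun v => by simpa only [hsymm _ v] using hrow v, ?_, ?_⟩
  · intro v w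
    simp only [P]
    split_ifs
    · exact hstar _ _
    · exact star_zero _
  · intro v w
    simp only [P]
    split_ifs
    · exact hsq _ _
    · exact mul_zero _
  · intro v w h
    exact if_neg h
  · intro v w i hi
    simp only [P]
    split_ifs
    · exact heig v.1 ⟨i, hi⟩ _
    · rw [mul_zero, smul_zero]

end Graph

/-! ### The operator solution inside `C(Qut(G(M, b)))` -/

/-- The map `f ↦ ∑ w, f w • u_{vw}` on integral functions `f` given by a row of the fundamental
representation. It is multiplicative and unital because the entries of the row are orthogonal
projections with sum `1`, so computations with elements of its range reduce to pointwise ones. -/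
def ColoredGraph.rowHom {V : Type u} {C : Type v} {D : Type w} [Fintype V]
    (G : ColoredGraph V C D) (v : V) : (V → ℤ) →+* G.QutAlgebra where
  toFun f := ∑ w, f w • G.u v w
  map_one' := by simp only [Pi.one_apply, one_smul, G.sum_row]
  map_zero' := by simp
  map_add' f g := by simp only [Pi.add_apply, add_smul, Finset.sum_add_distrib]
  map_mul' f g := by
    classical
    rw [Finset.sum_mul_sum]
    refine Finset.sum_congr rfl fun w _ => ?_
    rw [Finset.sum_eq_single w]
    · rw [smul_mul_smul_comm, G.u_mul_self, Pi.mul_apply]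
    · intro t _ ht
      rw [smul_mul_smul_comm, G.u_mul_u_row, if_neg ht.symm, smul_zero]
    · simp

lemma ColoredGraph.rowHom_apply {V : Type u} {C : Type v} {D : Type w} [Fintype V]
    (G : ColoredGraph V C D) (v : V) (f : V → ℤ) : G.rowHom v f = ∑ w, f w • G.u v w := rfl

section Graph

variable {m n : ℕ} {M : Matrix (Fin m) (Fin n) (ZMod 2)} {b : Fin m → ZMod 2}

/-- The variable `xᵢ`, computed from the row of the vertex `v`: the sum over `w` of the projections
`u_{vw}`, with the signs by which `αᵢ` changes from `v` to `w`. -/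
def rowVar (v : SystemVertex M b) (i : Fin n) : (systemGraph M b).QutAlgebra :=
  ∑ w, (v.sign i * w.sign i) • (systemGraph M b).u v w

lemma rowVar_eq_rowHom (v : SystemVertex M b) (i : Fin n) :
    rowVar v i = (systemGraph M b).rowHom v fun w => ((v.sign i * w.sign i : ℤˣ) : ℤ) := rfl

lemma star_rowVar (v : SystemVertex M b) (i : Fin n) : star (rowVar v i) = rowVar v i := by
  simp only [rowVar, star_sum, Units.smul_def, star_zsmul, ColoredGraph.star_u]

lemma rowVar_mul_self (v : SystemVertex M b) (i : Fin n) : rowVar v i * rowVar v i = 1 := by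
  rw [rowVar_eq_rowHom, ← map_mul, ← map_one ((systemGraph M b).rowHom v)]
  congr 1
  funext w
  rw [Pi.mul_apply, ← Units.val_mul, Int.units_mul_self]
  rfl

lemma rowVar_comm (v : SystemVertex M b) (i j : Fin n) :
    rowVar v i * rowVar v j = rowVar v j * rowVar v i := by
  rw [rowVar_eq_rowHom, rowVar_eq_rowHom, ← map_mul, mul_comm, map_mul]

lemma prod_rowVar (v : SystemVertex M b) :
    (((List.finRange n).filter fun i => M v.1 i = 1).map (rowVar v)).prod = 1 := by
  have h : rowVar v = (systemGraph M b).rowHom v ∘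
      fun i w => ((v.sign i * w.sign i : ℤˣ) : ℤ) := rfl
  rw [h, ← List.map_map, ← map_list_prod, prod_map_filter_finRange,
    ← map_one ((systemGraph M b).rowHom v), ColoredGraph.rowHom_apply, ColoredGraph.rowHom_apply]
  refine Finset.sum_congr rfl fun w _ => ?_
  by_cases hw : v.1 = w.1
  · congr 1
    rw [Finset.prod_apply, ← Units.coe_prod, Finset.prod_mul_distrib, v.prod_sign]
    have hw' : ∏ i : equationSupport M v.1, w.sign i = (-1) ^ (b v.1).val := by
      rw [hw, w.prod_sign]
    rw [hw', Int.units_mul_self]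
    rfl
  · rw [(systemGraph M b).u_color v w hw, smul_zero, smul_zero]

lemma rowVar_mul_u (v w : SystemVertex M b) (i : Fin n) :
    rowVar v i * (systemGraph M b).u v w =
      (v.sign i * w.sign i) • (systemGraph M b).u v w := by
  classical
  rw [rowVar, Finset.sum_mul, Finset.sum_eq_single w]
  · rw [smul_mul_assoc, ColoredGraph.u_mul_self]
  · intro t _ ht
    rw [smul_mul_assoc, ColoredGraph.u_mul_u_row, if_neg ht, smul_zero]
  · simp

/-- Adding up the adjacency matrices of all edge colors `d`, weighted by the value of `d` at `i`,
gives the matrix `(αᵢ βᵢ)` up to its diagonal. -/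
lemma sum_adjMatrix {v w : SystemVertex M b} {i : Fin n} (hv : M v.1 i = 1) (hw : M w.1 i = 1)
    (B : Type*) [Ring B] [Decidable (v = w)] :
    ∑ d : Fin n → Option ℤˣ, ((d i).elim 0 fun s => (s : ℤ)) • (systemGraph M b).adjMatrix d B v w =
      (v.sign i * w.sign i) • (1 : B) - if v = w then 1 else 0 := by
  classical
  simp only [adjMatrix_systemGraph]
  split_ifs with h
  · subst h
    rw [Int.units_mul_self, one_smul, sub_self]
    exact Finset.sum_eq_zero fun d _ => by rw [if_neg (fun h => h.1.1 rfl), smul_zero]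
  · rw [Finset.sum_eq_single (symmDiffColor v w), if_pos ⟨⟨h, i, hv, hw⟩, rfl⟩,
      symmDiffColor_of_mem hv hw, sub_zero]
    · rfl
    · intro d _ hd
      rw [if_neg (fun h => hd h.2.symm), smul_zero]
    · simp

/-- The variable `xᵢ` computed from the row of `v` agrees with the one computed from the column
of `w`, for any two vertices whose equations contain `i`. -/
lemma rowVar_eq_col {v w : SystemVertex M b} {i : Fin n} (hv : M v.1 i = 1) (hw : M w.1 i = 1) :
    rowVar v i = ∑ k, (k.sign i * w.sign i) • (systemGraph M b).u k w := by
  classical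
  have h : ∑ k, ∑ d : Fin n → Option ℤˣ, (systemGraph M b).u v k *
        (((d i).elim 0 fun s => (s : ℤ)) • (systemGraph M b).adjMatrix d _ k w) =
      ∑ k, ∑ d : Fin n → Option ℤˣ,
        (((d i).elim 0 fun s => (s : ℤ)) • (systemGraph M b).adjMatrix d _ v k) *
          (systemGraph M b).u k w := by
    rw [Finset.sum_comm]
    simp only [mul_smul_comm, smul_mul_assoc, ← Finset.smul_sum, ColoredGraph.u_adj]
    simp only [Finset.smul_sum]
    exact Finset.sum_comm
  -- on both sides the diagonal correction contributes `u v w`, which cancels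
  have hleft : ∀ k, ∑ d : Fin n → Option ℤˣ, (systemGraph M b).u v k *
      (((d i).elim 0 fun s => (s : ℤ)) • (systemGraph M b).adjMatrix d _ k w) =
      (k.sign i * w.sign i) • (systemGraph M b).u v k -
        if k = w then (systemGraph M b).u v w else 0 := fun k => by
    by_cases hk : v.1 = k.1
    · rw [← Finset.mul_sum, sum_adjMatrix (hk ▸ hv) hw, mul_sub, mul_smul_comm, mul_one]
      split_ifs with hkw
      · rw [hkw, mul_one]
      · rw [mul_zero]
    · simp only [(systemGraph M b).u_color v k hk, zero_mul, smul_zero, Finset.sum_const_zero]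
      split_ifs with hkw
      · rw [← hkw, (systemGraph M b).u_color v k hk, sub_zero]
      · rw [sub_zero]
  have hright : ∀ k, ∑ d : Fin n → Option ℤˣ,
      (((d i).elim 0 fun s => (s : ℤ)) • (systemGraph M b).adjMatrix d _ v k) *
        (systemGraph M b).u k w =
      (v.sign i * k.sign i) • (systemGraph M b).u k w -
        if v = k then (systemGraph M b).u v w else 0 := fun k => by
    by_cases hk : k.1 = w.1
    · rw [← Finset.sum_mul, sum_adjMatrix hv (hk ▸ hw), sub_mul, smul_mul_assoc, one_mul]
      split_ifs with hkw
      · rw [hkw, one_mul]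
      · rw [zero_mul]
    · simp only [(systemGraph M b).u_color k w hk, mul_zero, smul_zero, Finset.sum_const_zero]
      split_ifs with hkw
      · rw [hkw, (systemGraph M b).u_color k w hk, sub_zero]
      · rw [sub_zero]
  simp only [hleft, hright, Finset.sum_sub_distrib, Finset.sum_ite_eq, Finset.sum_ite_eq',
    Finset.mem_univ, if_true, sub_left_inj] at h
  have h2 := congrArg ((v.sign i * w.sign i) • ·) h
  simp only [Finset.smul_sum, smul_smul] at h2
  have e1 : ∀ a c d : ℤˣ, a * c * (d * c) = a * d := fun a c d => by
    rw [mul_mul_mul_comm, Int.units_mul_self, mul_one]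
  have e2 : ∀ a c d : ℤˣ, a * c * (a * d) = d * c := fun a c d => by
    rw [mul_mul_mul_comm, Int.units_mul_self, one_mul, mul_comm]
  simp only [e1, e2] at h2
  exact h2

lemma rowVar_eq_rowVar {v w : SystemVertex M b} {i : Fin n} (hv : M v.1 i = 1)
    (hw : M w.1 i = 1) : rowVar v i = rowVar w i :=
  (rowVar_eq_col hv hw).trans (rowVar_eq_col hw hw).symm

/-- Every variable `xᵢ` that occurs in some equation yields a well-defined element of
`C(Qut(G(M, b)))`, independent of the vertex from which it is computed. -/
lemma exists_qutVar (hM : ∀ i : Fin n, ∃ k : Fin m, M k i = 1) (b : Fin m → ZMod 2) :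
    ∃ x : Fin n → (systemGraph M b).QutAlgebra,
      ∀ (v : SystemVertex M b) i, M v.1 i = 1 → x i = rowVar v i := by
  choose k hk using hM
  choose v hv using fun i => exists_vertex_of_mem (b := b) (hk i)
  exact ⟨fun i => rowVar (v i) i, fun w i hw => rowVar_eq_rowVar (by rw [hv, hk]) hw⟩

variable {x : Fin n → (systemGraph M b).QutAlgebra}

lemma isOperatorSolution_of_eq_rowVar (hM : ∀ i : Fin n, ∃ k : Fin m, M k i = 1)
    (hx : ∀ (v : SystemVertex M b) i, M v.1 i = 1 → x i = rowVar v i) :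
    IsOperatorSolution M x := by
  have hex : ∀ i, ∃ v : SystemVertex M b, M v.1 i = 1 := fun i => by
    obtain ⟨k, hk⟩ := hM i
    obtain ⟨v, rfl⟩ := exists_vertex_of_mem (b := b) hk
    exact ⟨v, hk⟩
  refine ⟨fun i => ?_, fun i => ?_, fun k i j hi hj => ?_, fun k => ?_⟩
  · obtain ⟨v, hv⟩ := hex i
    rw [hx v i hv, star_rowVar]
  · obtain ⟨v, hv⟩ := hex i
    rw [hx v i hv, rowVar_mul_self]
  · obtain ⟨v, rfl⟩ := exists_vertex_of_mem (b := b) hi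
    rw [hx v i hi, hx v j hj, rowVar_comm]
  · by_cases hk : ∃ i, M k i = 1
    · obtain ⟨i, hi⟩ := hk
      obtain ⟨v, rfl⟩ := exists_vertex_of_mem (b := b) hi
      rw [← prod_rowVar v]
      refine congrArg List.prod (List.map_congr_left fun j hj => hx v j ?_)
      simpa using (List.mem_filter.mp hj).2
    -- the product over an empty equation is `1`, even if the equation has no vertices
    · push Not at hk
      simp [hk]

/-- The fundamental representation is itself a spectral matrix for the `xᵢ`. -/
lemma isSpectralMatrix_u (hx : ∀ (v : SystemVertex M b) i, M v.1 i = 1 → x i = rowVar v i) :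
    IsSpectralMatrix x (systemGraph M b).u where
  star_eq := (systemGraph M b).star_u
  mul_self := (systemGraph M b).u_mul_self
  row := (systemGraph M b).sum_row
  col := (systemGraph M b).sum_col
  color := (systemGraph M b).u_color
  eigen v w i hi := by rw [hx v i hi, rowVar_mul_u]

/-- The variables are group-like: `Δ_G(xᵢ) = xᵢ ⊗ xᵢ`. -/
lemma comul_eq_tmul (hM : ∀ i : Fin n, ∃ k : Fin m, M k i = 1)
    (hx : ∀ (v : SystemVertex M b) i, M v.1 i = 1 → x i = rowVar v i) (i : Fin n) :
    (systemGraph M b).comul (x i) = MinTensor.tmul (x i) (x i) := by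
  have hz : ∀ (s : ℤˣ) (a c : (systemGraph M b).QutAlgebra),
      MinTensor.tmul (s • a) c = s • MinTensor.tmul a c ∧
      MinTensor.tmul a (s • c) = s • MinTensor.tmul a c := fun s a c => by
    rcases Int.units_eq_one_or s with rfl | rfl <;>
      simp [MinTensor.tmul, Units.neg_smul, TensorProduct.neg_tmul, TensorProduct.tmul_neg]
  obtain ⟨k, hk⟩ := hM i
  obtain ⟨v, rfl⟩ := exists_vertex_of_mem (b := b) hk
  calc (systemGraph M b).comul (x i)
      = ∑ w, (v.sign i * w.sign i) • ∑ t,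
          MinTensor.tmul ((systemGraph M b).u v t) ((systemGraph M b).u t w) := by
        rw [hx v i hk, rowVar, map_sum]
        simp only [Units.smul_def, map_zsmul, ColoredGraph.comul_u]
    _ = ∑ t, MinTensor.tmul ((v.sign i * t.sign i) • (systemGraph M b).u v t) (rowVar t i) := by
        simp only [Finset.smul_sum]
        rw [Finset.sum_comm]
        refine Finset.sum_congr rfl fun t _ => ?_
        rw [rowVar, MinTensor.tmul_sum]
        refine Finset.sum_congr rfl fun w _ => ?_
        rw [(hz _ _ _).1, (hz _ _ _).2, smul_smul, mul_assoc, ← mul_assoc (t.sign i),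
          Int.units_mul_self, one_mul]
    _ = ∑ t, MinTensor.tmul ((v.sign i * t.sign i) • (systemGraph M b).u v t) (x i) := by
        refine Finset.sum_congr rfl fun t _ => ?_
        by_cases ht : v.1 = t.1
        · rw [hx t i (ht ▸ hk)]
        · rw [(systemGraph M b).u_color v t ht, smul_zero, MinTensor.zero_tmul,
            MinTensor.zero_tmul]
    _ = MinTensor.tmul (x i) (x i) := by
        rw [← MinTensor.sum_tmul]
        exact congrArg (MinTensor.tmul · (x i)) (hx v i hk).symm

end Graph

end
/-- For every linear system `M x = b` over `𝔽₂` in which every variable occurs in some equation,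
the quantum automorphism group of `G(M, b)` is the dual of the homogeneous solution group. -/
theorem theorem3p6 {m n : ℕ} (M : Matrix (Fin m) (Fin n) (ZMod 2)) (b : Fin m → ZMod 2)
    (hM : ∀ i : Fin n, ∃ k : Fin m, M k i = 1) :
    ∃ φ : GroupCStarAlgebra (HomogeneousSolutionGroup M) ≃⋆ₐ[ℂ] (systemGraph M b).QutAlgebra,
      ∀ x : GroupCStarAlgebra (HomogeneousSolutionGroup M),
        (systemGraph M b).comul (φ x) =
          MinTensor.map (φ : GroupCStarAlgebra (HomogeneousSolutionGroup M) →⋆ₐ[ℂ]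
              (systemGraph M b).QutAlgebra)
            (φ : GroupCStarAlgebra (HomogeneousSolutionGroup M) →⋆ₐ[ℂ]
              (systemGraph M b).QutAlgebra)
            (GroupCStarAlgebra.comul x) := by
  obtain ⟨x, hx⟩ := exists_qutVar hM b
  have hsol := isOperatorSolution_of_eq_rowVar hM hx
  have hgen := isOperatorSolution_solutionGen M
  obtain ⟨P, hP⟩ := hgen.exists_isSpectralMatrix b
  let f := hsol.lift
  let g := IsSpectralMatrix.lift hgen hP
  have hf : ∀ i, f (solutionGen M i) = x i := hsol.lift_solutionGen
  have hg : ∀ v w, g ((systemGraph M b).u v w) = P v w := IsSpectralMatrix.lift_u hgen hP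
  have hgf : g.comp f = StarAlgHom.id ℂ _ := solutionGroup_hom_ext fun i => by
    obtain ⟨k, hk⟩ := hM i
    obtain ⟨v, rfl⟩ := exists_vertex_of_mem (b := b) hk
    rw [StarAlgHom.comp_apply, hf, hx v i hk, rowVar, map_sum]
    simp only [Units.smul_def, map_zsmul, hg]
    simp only [← Units.smul_def, ← hP.eigen v _ i hk]
    rw [← Finset.mul_sum, hP.row, mul_one]
    rfl
  have hfg : f.comp g = StarAlgHom.id ℂ _ := UniversalCStarAlgebra.hom_ext fun ⟨v, w⟩ => by
    change f (g ((systemGraph M b).u v w)) = (systemGraph M b).u v w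
    rw [hg]
    have hfP := hP.map f
    simp only [hf] at hfP
    exact IsSpectralMatrix.unique hsol hfP (isSpectralMatrix_u hx) v w
  refine ⟨StarAlgEquiv.ofStarAlgHom f g hgf hfg, fun y => ?_⟩
  suffices h : (systemGraph M b).comul.comp f = (MinTensor.map f f).comp GroupCStarAlgebra.comul
    from DFunLike.congr_fun h y
  refine solutionGroup_hom_ext fun i => ?_
  rw [StarAlgHom.comp_apply, StarAlgHom.comp_apply, hf, comul_eq_tmul hM hx, solutionGen,
    GroupCStarAlgebra.comul_u, MinTensor.map_tmul]
  change _ = MinTensor.tmul (f (solutionGen M i)) (f (solutionGen M i))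
  rw [hf]
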